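/- **Setting.** Let $G=(V,E)$ be a finite acyclic directed graph (parallel edges allowed) with edge capacities $C:E\to\mathbb N$ (bits per unit of time), sources $s_x,s_y\in V$ and a finite set of terminals $T\subset V$ with $s_x,s_y\notin T$. For $S\subseteq V$ let $\rho_G(S)=\min_{t\in T}\rho(S;t)$, where $\rho(S;t)$ is the minimum, over $U\subseteq V$ with $S\subseteq U\not\ni t$, of the total capacity of the edges leaving $U$. Let $(X,Y)\sim p$ take values in a finite set $\mathcal X\times\mathcal Y$; entropies are in bits. Let $K=K_{X,Y}$ be the Gács–Körner common information: the connected component of $(X,Y)$ in the bipartite graph on $\mathcal X\sqcup\mathcal Y$ in which $x\sim y$ iff $p(x,y)>0$. The problem $(G,C,p)$ is *feasible* if $$H(X|Y)\le\rho_G(s_x),\quad H(Y|X)\le\rho_G(s_y),\quad H(X,Y)\le\rho_G(s_x,s_y).$$ **Separation by source decomposition.** The $n$-delayed network $G^n$ has capacities $nC(e)$. The expanded network of $G^n$ has three more vertices $s_{X'},s_{Y'},s_K$ and infinite-capacity edges $s_{X'}\to s_x$, $s_{Y'}\to s_y$, $s_K\to s_x$, $s_K\to s_y$. For $\varepsilon>0$,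 say that $(G^n,p)$ is *feasible by source decomposition with tolerance $\varepsilon$* if, for some $k\ge(1-\varepsilon)n$ and some $a,b,c\in\mathbb N$, there are: 1. separate source codes for $k$ i.i.d. outcomes $(X_i,Y_i)\sim p$ with common parts $K_i$: encoders of $K^k$ into $c$ codewords, of $X^k$ into $a$ codewords and of $Y^k$ into $b$ codewords, and decoders that recover $K^k$ from its own codeword, $X^k$ from its codeword and the decoded common part, and $Y^k$ from its codeword and the decoded common part, all three correctly with total probability at least $1-\varepsilon$ (given $K_i$, the outcome $X_i$ amounts to its position $X'_i$ in its component, and likewise $Y_i$ to $Y'_i$); 2. a network code on the expanded network of $G^n$ that sends the three codewords as independent messages: for every one of the $abc$ triples of messages placed at $s_{X'},s_{Y'},s_K$, every terminal recovers the triple without error, an edge of finite capacity $nC(e)$ carrying one of at most $2^{nC(e)}$ symbols. **Theorem.** Let $(G,C,p)$ be feasible. There is $\varepsilon_0>0$ such that for every $\varepsilon\in(0,\varepsilon_0)$ and all sufficiently large $n$, $(G^n,p)$ is feasible by source decomposition with tolerance $\varepsilon$ if and only if $$H(X|K)\le\rho_G(s_x),\quad H(Y|K)\le\rho_G(s_y),\quad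 H(X|K)+H(Y|K)+H(K)\le\rho_G(s_x,s_y).$$ -/

import Mathlib

/-- Entropy, in bits, of a distribution on a finite set. -/
noncomputable def entropy {α : Type*} [Fintype α] (q : PMF α) : ℝ :=
  ∑ a, (q a).toReal * Real.logb 2 (1 / (q a).toReal)

/-- Conditional entropy `H(A|B)`, in bits, of a pair `(A,B)` with joint law `q` on a finite set:
the sum of `q(a,b) log₂ (q_B(b) / q(a,b))`, where `q_B` is the second marginal. -/
noncomputable def condEntropy {α β : Type*} [Fintype α] [Fintype β] (q : PMF (α × β)) : ℝ :=
  ∑ z : α × β, (q z).toReal * Real.logb 2 ((q.map Prod.snd z.2).toReal / (q z).toReal)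

/-- The bipartite representation of the law `p` of `(X,Y)`: the vertices are the disjoint union of
the two alphabets, and `x`, `y` are adjacent iff `p(x,y) > 0`. -/
def bipartiteGraph {𝒳 𝒴 : Type*} (p : PMF (𝒳 × 𝒴)) : SimpleGraph (𝒳 ⊕ 𝒴) :=
  SimpleGraph.fromRel fun u v => ∃ x y, u = Sum.inl x ∧ v = Sum.inr y ∧ 0 < p (x, y)

/-- The set of values of the Gács–Körner common information: the connected components of the
bipartite representation. -/
abbrev CommonPart {𝒳 𝒴 : Type*} (p : PMF (𝒳 × 𝒴)) : Type _ :=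
  (bipartiteGraph p).ConnectedComponent

noncomputable instance {𝒳 𝒴 : Type*} [Fintype 𝒳] [Fintype 𝒴] (p : PMF (𝒳 × 𝒴)) :
    Fintype (CommonPart p) :=
  Fintype.ofFinite _

/-- The Gács–Körner common information `K = K_{X,Y}`: the component in which `(X,Y)` falls. It is
written as a function of `X`; almost surely it is the same function of `Y`, see
`commonInfo_eq_of_pos`. -/
def commonInfo {𝒳 𝒴 : Type*} (p : PMF (𝒳 × 𝒴)) (z : 𝒳 × 𝒴) : CommonPart p :=
  (bipartiteGraph p).connectedComponentMk (Sum.inl z.1)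

theorem commonInfo_eq_of_pos {𝒳 𝒴 : Type*} (p : PMF (𝒳 × 𝒴)) (x : 𝒳) (y : 𝒴)
    (h : 0 < p (x, y)) :
    commonInfo p (x, y) = (bipartiteGraph p).connectedComponentMk (Sum.inr y) := by
  refine SimpleGraph.ConnectedComponent.sound (SimpleGraph.Adj.reachable ?_)
  simp only [bipartiteGraph, SimpleGraph.fromRel_adj]
  exact ⟨by simp, Or.inl ⟨x, y, rfl, rfl, h⟩⟩

/-- `H(K)`. -/
noncomputable def entropyK {𝒳 𝒴 : Type*} [Fintype 𝒳] [Fintype 𝒴] (p : PMF (𝒳 × 𝒴)) : ℝ :=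
  entropy (p.map (commonInfo p))

/-- `H(X|K)`. -/
noncomputable def condEntropyXK {𝒳 𝒴 : Type*} [Fintype 𝒳] [Fintype 𝒴] (p : PMF (𝒳 × 𝒴)) : ℝ :=
  condEntropy (p.map fun z => (z.1, commonInfo p z))

/-- `H(Y|K)`. -/
noncomputable def condEntropyYK {𝒳 𝒴 : Type*} [Fintype 𝒳] [Fintype 𝒴] (p : PMF (𝒳 × 𝒴)) : ℝ :=
  condEntropy (p.map fun z => (z.2, commonInfo p z))

/-- A directed graph with vertices `V` and edges `E` (parallel edges are allowed). -/
structure Network (V E : Type*) where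
  tail : E → V
  head : E → V

namespace Network

/-- There is no directed cycle. -/
def Acyclic {V E : Type*} (G : Network V E) : Prop :=
  ∀ v, ¬ Relation.TransGen (fun u w => ∃ e, G.tail e = u ∧ G.head e = w) v v

open scoped Classical in
/-- Total capacity of the edges that leave the vertex set `U`. -/
noncomputable def cutValue {V E : Type*} [Fintype E] (G : Network V E) (C : E → ℕ)
    (U : Finset V) : ℕ :=
  ∑ e with G.tail e ∈ U ∧ G.head e ∉ U, C e

/-- The min-cut `ρ(S;t)` (it is `⊤` if `t ∈ S`, as no cut separates `t` from `S` then). -/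
noncomputable def minCut {V E : Type*} [Fintype E] (G : Network V E) (C : E → ℕ)
    (S : Finset V) (t : V) : ℕ∞ :=
  ⨅ (U : Finset V) (_ : S ⊆ U ∧ t ∉ U), (G.cutValue C U : ℕ∞)

/-- The capacity function `ρ_G(S)`, the minimum over the terminals `t ∈ T` of `ρ(S;t)`. -/
noncomputable def capacity {V E : Type*} [Fintype E] (G : Network V E) (C : E → ℕ)
    (T : Finset V) (S : Finset V) : ℕ∞ :=
  ⨅ t ∈ T, G.minCut C S t

/-- Capacities of the `n`-delayed network. -/
def delayed {E : Type*} (n : ℕ) (C : E → ℕ) : E → ℕ := fun e => n * C e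

/-- What a vertex `v` sees when edge `e` carries `sym e` and the source `i`, located at `src i`,
has the message `m i`: the symbols on the edges into `v` and the messages generated at `v`. -/
def view {V E ι : Type*} (G : Network V E) (src : ι → V) {M : ι → Type*} (v : V)
    (sym : E → ((i : ι) → M i) → ℕ) (m : (i : ι) → M i) :
    ({e : E // G.head e = v} → ℕ) × ((i : {i : ι // src i = v}) → M i) :=
  (fun e => sym e m, fun i => m i)

/-- A (zero-error, block) network code on an acyclic network whose edge `e` carries `C e` bits
(no restriction if `C e = ⊤`). The sources `i` choose their messages `m i ∈ M i` freely, that is,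
the code has to work for every combination of messages; every terminal recovers all of them. -/
structure Code {V E ι : Type*} (G : Network V E) (C : E → ℕ∞) (src : ι → V) (T : Set V)
    (M : ι → Type*) where
  /-- the symbol that the edge `e` carries when the messages are `m` -/
  sym : E → ((i : ι) → M i) → ℕ
  sym_lt : ∀ (e : E) (c : ℕ), C e = c → ∀ m, sym e m < 2 ^ c
  /-- the symbol on an edge is a function of what its tail sees -/
  encode : ∀ e, Function.FactorsThrough (sym e) (G.view src (G.tail e) sym)
  /-- the messages are a function of what a terminal sees -/
  decode : ∀ t ∈ T, Function.FactorsThrough id (G.view src t sym)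

end Network

/-- The three latent sources `X'`, `Y'`, `K`. -/
inductive Latent where
  | x' | y' | k

/-- The four new edges of the expanded network: from `s_{X'}` to `s_x`, from `s_{Y'}` to `s_y`, and
from `s_K` to `s_x` and to `s_y`. -/
inductive LatentEdge where
  | x'_x | y'_y | k_x | k_y

/-- The expanded network: the latent sources are added as vertices. -/
def Network.expanded {V E : Type*} (G : Network V E) (sx sy : V) :
    Network (V ⊕ Latent) (E ⊕ LatentEdge) where
  tail
    | .inl e => .inl (G.tail e)
    | .inr .x'_x => .inr .x'
    | .inr .y'_y => .inr .y'
    | .inr .k_x => .inr .k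
    | .inr .k_y => .inr .k
  head
    | .inl e => .inl (G.head e)
    | .inr .x'_x => .inl sx
    | .inr .y'_y => .inl sy
    | .inr .k_x => .inl sx
    | .inr .k_y => .inl sy

/-- Capacities on the expanded network: the new edges have infinite capacity. -/
def expandedCap {E : Type*} (C : E → ℕ) : E ⊕ LatentEdge → ℕ∞
  | .inl e => C e
  | .inr _ => ⊤

/-- Message sets of the latent sources, with `a`, `b`, `c` messages. -/
def LatentMessage (a b c : ℕ) : Latent → Type
  | .x' => Fin a
  | .y' => Fin b
  | .k => Fin c

/-- Separate source codes for blocks of `k` outcomes after source decomposition. The block of the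
common parts `K_i` is encoded and decoded on its own. The blocks of the `X_i` and of the `Y_i` are
encoded separately, and each is decoded with the help of the `K_i` only: given `K_i`, the outcome
`X_i` is the same datum as its position `X'_i` among the symbols in its component, and likewise
`Y_i`. The numbers of codewords are `a` for `X'`, `b` for `Y'` and `c` for `K`. -/
structure DecompositionCode {𝒳 𝒴 : Type*} (p : PMF (𝒳 × 𝒴)) (k a b c : ℕ) where
  encX : (Fin k → 𝒳) → Fin a
  encY : (Fin k → 𝒴) → Fin b
  encK : (Fin k → CommonPart p) → Fin c
  decK : Fin c → (Fin k → CommonPart p)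
  decX : Fin a → (Fin k → CommonPart p) → (Fin k → 𝒳)
  decY : Fin b → (Fin k → CommonPart p) → (Fin k → 𝒴)

namespace DecompositionCode

/-- The outcomes `z = (x_i, y_i)_i` are recovered correctly from the three codewords. -/
def Correct {𝒳 𝒴 : Type*} {p : PMF (𝒳 × 𝒴)} {k a b c : ℕ} (D : DecompositionCode p k a b c)
    (z : Fin k → 𝒳 × 𝒴) : Prop :=
  let K := D.decK (D.encK fun i => commonInfo p (z i))
  (K = fun i => commonInfo p (z i)) ∧
    D.decX (D.encX fun i => (z i).1) K = (fun i => (z i).1) ∧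
    D.decY (D.encY fun i => (z i).2) K = (fun i => (z i).2)

open scoped Classical in
/-- Probability of correct recovery of `k` i.i.d. outcomes of law `p`. -/
noncomputable def probCorrect {𝒳 𝒴 : Type*} [Fintype 𝒳] [Fintype 𝒴] {p : PMF (𝒳 × 𝒴)}
    {k a b c : ℕ} (D : DecompositionCode p k a b c) : ℝ :=
  ∑ z : Fin k → 𝒳 × 𝒴 with D.Correct z, ∏ i, (p (z i)).toReal

end DecompositionCode

/-- The rate `r ≥ 0` (in bits per unit of time) is at most the cut value `ρ`. -/
def RateLE (r : ℝ) (ρ : ℕ∞) : Prop := ENNReal.ofReal r ≤ (ρ : ENNReal)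

open scoped Classical in
/-- The two-source multicast problem is feasible: `H(X|Y) ≤ ρ_G(s_x)`, `H(Y|X) ≤ ρ_G(s_y)` and
`H(X,Y) ≤ ρ_G(s_x,s_y)`. -/
def Feasible {V E 𝒳 𝒴 : Type*} [Fintype E] [Fintype 𝒳] [Fintype 𝒴] (G : Network V E) (C : E → ℕ)
    (sx sy : V) (T : Finset V) (p : PMF (𝒳 × 𝒴)) : Prop :=
  RateLE (condEntropy p) (G.capacity C T {sx}) ∧
  RateLE (condEntropy (p.map Prod.swap)) (G.capacity C T {sy}) ∧
  RateLE (entropy p) (G.capacity C T {sx, sy})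

/-- Separation by source decomposition works, up to the tolerance `ε`, on the network with
capacities `C` used to transmit at least `r` outcomes of the pair of sources: a block of `k ≥ r`
outcomes is encoded by separate source codes for `X'`, `Y'`, `K`, recovered from the three
codewords with probability at least `1 - ε`, and the codewords are sent to all terminals by a
network code for three independent sources on the expanded network. -/
def FeasibleByDecomposition {V E 𝒳 𝒴 : Type*} [Fintype 𝒳] [Fintype 𝒴] (G : Network V E)
    (C : E → ℕ) (sx sy : V) (T : Finset V) (p : PMF (𝒳 × 𝒴)) (ε r : ℝ) : Prop :=
  ∃ k a b c : ℕ, r ≤ k ∧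
    (∃ D : DecompositionCode p k a b c, 1 - ε ≤ D.probCorrect) ∧
    Nonempty ((G.expanded sx sy).Code (expandedCap C) Sum.inr (Sum.inl '' (T : Set V))
      (LatentMessage a b c))

/-!
The three latent sources `X'`, `Y'`, `K` are sent as independent messages, so the three cut
conditions are those of a multicast problem with independent sources of entropies `H(X|K)`,
`H(Y|K)`, `H(K)`, where `K` is available at both `s_x` and `s_y`.

*Sufficiency.* By the asymptotic equipartition property, blocks of length `k ≈ (1 - ε) n` are
encoded by `k H (1 + ε)` bits for each of the three entropies `H` (`exists_decompositionCode`). As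
`(1 - ε) (1 + ε) < 1`, the cuts exceed these numbers of bits by a margin linear in `n`, except
that a source of entropy zero has no margin, but sends no bits either. With such margins a random
linear network code over the field of two elements works, and the max-flow min-cut theorem is not
needed: for a fixed nonzero source string `w`, let `U` be the set of the vertices that see
something nonzero. If a terminal is outside `U`, then all edges out of `U` carry zero although
their tails see something nonzero, which has probability `2 ^ (-cut U)`
(`LinearNetwork.card_blocked_mul_le`). A union bound over `w`, the terminals and `U` yields a code
under which no terminal loses any nonzero string (`LinearNetwork.exists_code`); by linearity this
is decoding without error.

*Necessity.* If the messages that enter the network outside `U` are fixed, then the symbols on the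
edges that leave `U` determine what a terminal outside `U` sees (`eq_of_cut_eq`). So the number of
messages, or of triples of messages, is at most two to the power of the cut value, and the
converse of source coding (`decompositionCode_converse`) bounds it from below. If one of the cut
conditions fails, the two bounds contradict each other once `ε` is small and `n` is large. The
tolerance `ε₀` depends on the amount by which the condition fails; if none fails, every `ε < 1`
will do.
-/

/-! ### Sums over blocks of independent outcomes -/

theorem sum_pi_prod {Ω : Type*} [Fintype Ω] {k : ℕ} (g : Fin k → Ω → ℝ) :
    ∑ z : Fin k → Ω, ∏ i, g i (z i) = ∏ i, ∑ x, g i x := by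
  classical
  rw [Finset.prod_univ_sum, Fintype.piFinset_univ]

theorem sum_pi_prod_eq_one {Ω : Type*} [Fintype Ω] {k : ℕ} {P : Ω → ℝ} (h1 : ∑ x, P x = 1) :
    ∑ z : Fin k → Ω, ∏ i, P (z i) = 1 := by
  rw [sum_pi_prod (fun _ => P)]; simp [h1]

/-- Variances of independent centred variables add up. -/
theorem sum_pi_prod_mul_sq {Ω : Type*} [Fintype Ω] {k : ℕ} {P V : Ω → ℝ}
    (h1 : ∑ x, P x = 1) (h0 : ∑ x, P x * V x = 0) :
    ∑ z : Fin k → Ω, (∏ i, P (z i)) * (∑ i, V (z i)) ^ 2 = k * ∑ x, P x * V x ^ 2 := by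
  classical
  have cov : ∀ i j : Fin k, ∑ z : Fin k → Ω, (∏ l, P (z l)) * (V (z i) * V (z j)) =
      if i = j then ∑ x, P x * V x ^ 2 else 0 := by
    intro i j
    have e : ∀ z : Fin k → Ω, (∏ l, P (z l)) * (V (z i) * V (z j)) =
        ∏ l, (P (z l) * ((if l = i then V (z l) else 1) * (if l = j then V (z l) else 1))) := by
      intro z
      rw [Finset.prod_mul_distrib, Finset.prod_mul_distrib]
      simp
    simp_rw [e]
    rw [sum_pi_prod (fun l x => P x * ((if l = i then V x else 1) * (if l = j then V x else 1)))]
    split_ifs with hij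
    · subst hij
      rw [Finset.prod_eq_single i]
      · simp [sq]
      · intro l _ hl; simp [hl, h1]
      · simp
    · apply Finset.prod_eq_zero (Finset.mem_univ i)
      simp [hij, h0]
  calc ∑ z : Fin k → Ω, (∏ i, P (z i)) * (∑ i, V (z i)) ^ 2
      = ∑ z : Fin k → Ω, ∑ i, ∑ j, (∏ l, P (z l)) * (V (z i) * V (z j)) := by
        refine Finset.sum_congr rfl fun z _ => ?_
        rw [sq, Finset.sum_mul_sum, Finset.mul_sum]
        simp_rw [Finset.mul_sum]
    _ = ∑ i, ∑ j, ∑ z : Fin k → Ω, (∏ l, P (z l)) * (V (z i) * V (z j)) := by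
        rw [Finset.sum_comm]
        exact Finset.sum_congr rfl fun i _ => Finset.sum_comm
    _ = _ := by simp [cov]

open scoped Classical in
/-- Weak law of large numbers, by Chebyshev's inequality. -/
theorem weak_law {Ω : Type*} [Fintype Ω] {P : Ω → ℝ} (hP : ∀ x, 0 ≤ P x) (h1 : ∑ x, P x = 1)
    (W : Ω → ℝ) {δ η : ℝ} (hδ : 0 < δ) (hη : 0 < η) :
    ∃ N : ℕ, ∀ k ≥ N,
      ∑ z : Fin k → Ω with k * δ < |∑ i, W (z i) - k * ∑ x, P x * W x|, ∏ i, P (z i) ≤ η := by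
  set H := ∑ x, P x * W x with hH
  set v := ∑ x, P x * (W x - H) ^ 2 with hv
  have h0 : ∑ x, P x * (W x - H) = 0 := by
    simp_rw [mul_sub]; rw [Finset.sum_sub_distrib, ← Finset.sum_mul, h1, ← hH]; ring
  obtain ⟨N, hN⟩ := exists_nat_gt (v / (δ ^ 2 * η))
  refine ⟨N + 1, fun k hk => ?_⟩
  have hk0 : (0 : ℝ) < k := by exact_mod_cast (by omega : 0 < k)
  have hkN : v / (δ ^ 2 * η) < k := hN.trans_le (by exact_mod_cast (by omega : N ≤ k))
  rw [div_lt_iff₀ (by positivity)] at hkN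
  have hs : ∀ z : Fin k → Ω, ∑ i, W (z i) - k * H = ∑ i, (W (z i) - H) := by
    intro z; simp
  have key := sum_pi_prod_mul_sq (k := k) h1 h0
  have hle : (k * δ) ^ 2 *
      ∑ z : Fin k → Ω with k * δ < |∑ i, W (z i) - k * H|, ∏ i, P (z i) ≤ k * v := by
    rw [← key, Finset.mul_sum]
    refine (Finset.sum_le_sum fun z hz => ?_).trans (Finset.sum_le_sum_of_subset_of_nonneg
      (Finset.filter_subset _ _) fun z _ _ =>
        mul_nonneg (Finset.prod_nonneg fun i _ => hP _) (sq_nonneg _))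
    rw [Finset.mem_filter, hs] at hz
    rw [mul_comm, ← sq_abs (∑ i, (W (z i) - H))]
    exact mul_le_mul_of_nonneg_left (pow_le_pow_left₀ (by positivity) hz.2.le 2)
      (Finset.prod_nonneg fun i _ => hP _)
  have hb : k * v ≤ (k * δ) ^ 2 * η := by nlinarith
  exact le_of_mul_le_mul_left (hle.trans hb) (by positivity)

theorem pmf_sum_toReal {Ω : Type*} [Fintype Ω] (p : PMF Ω) : ∑ x, (p x).toReal = 1 := by
  rw [← ENNReal.toReal_sum (fun x _ => p.apply_ne_top x), ← tsum_fintype (L := .unconditional _),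
    p.tsum_coe]
  simp

open scoped Classical in
theorem pmf_map_toReal {Ω Γ : Type*} [Fintype Ω] (p : PMF Ω) (h : Ω → Γ) (w : Γ) :
    (p.map h w).toReal = ∑ z, if w = h z then (p z).toReal else 0 := by
  rw [PMF.map_apply, tsum_fintype, ENNReal.toReal_sum]
  · refine Finset.sum_congr rfl fun z _ => ?_
    split_ifs <;> simp
  · intro z _
    split_ifs
    · exact p.apply_ne_top z
    · simp

/-- The law of the images of a block of independent outcomes. -/
theorem sum_pi_prod_map {Ω Γ : Type*} [Fintype Ω] [Fintype Γ] {k : ℕ} (p : PMF Ω) (h : Ω → Γ)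
    (F : (Fin k → Γ) → ℝ) :
    ∑ z : Fin k → Ω, (∏ i, (p (z i)).toReal) * F (fun i => h (z i)) =
      ∑ w : Fin k → Γ, (∏ i, (p.map h (w i)).toReal) * F w := by
  classical
  have e : ∀ w : Fin k → Γ, ∏ i, (p.map h (w i)).toReal =
      ∑ z : Fin k → Ω, if w = (fun i => h (z i)) then ∏ i, (p (z i)).toReal else 0 := by
    intro w
    simp_rw [pmf_map_toReal]
    rw [← sum_pi_prod (fun i x => if w i = h x then (p x).toReal else 0)]
    refine Finset.sum_congr rfl fun z _ => ?_
    rw [Finset.prod_ite_zero]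
    simp [funext_iff]
  simp_rw [e, Finset.sum_mul]
  rw [Finset.sum_comm]
  refine Finset.sum_congr rfl fun z _ => ?_
  simp

/-- The same for the probability of an event that depends on the images only. -/
theorem sum_filter_pi_prod_map {Ω Γ : Type*} [Fintype Ω] [Fintype Γ] {k : ℕ} (p : PMF Ω)
    (h : Ω → Γ) (S : (Fin k → Γ) → Prop) [DecidablePred fun z : Fin k → Ω => S fun i => h (z i)]
    {_ : DecidablePred S} :
    ∑ z : Fin k → Ω with S (fun i => h (z i)), ∏ i, (p (z i)).toReal =
      ∑ w : Fin k → Γ with S w, ∏ i, (p.map h (w i)).toReal := by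
  have := sum_pi_prod_map (k := k) p h (fun w => if S w then 1 else 0)
  rw [Finset.sum_filter, Finset.sum_filter]
  simpa using this

/-! ### Conditional entropy and source codes with side information -/

/-- The conditional probability `q(a|b)` (zero if `b` has probability zero). -/
noncomputable def condProb {α β : Type*} (q : PMF (α × β)) (w : α × β) : ℝ :=
  (q w).toReal / (q.map Prod.snd w.2).toReal

theorem condProb_nonneg {α β : Type*} (q : PMF (α × β)) (w : α × β) : 0 ≤ condProb q w := by
  unfold condProb; positivity

section
variable {α β : Type*} [Fintype α] [Fintype β] (q : PMF (α × β))

theorem map_snd_toReal (b : β) : (q.map Prod.snd b).toReal = ∑ a, (q (a, b)).toReal := by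
  classical
  rw [pmf_map_toReal, Fintype.sum_prod_type]
  simp

theorem toReal_le_map_snd (w : α × β) : (q w).toReal ≤ (q.map Prod.snd w.2).toReal := by
  rw [map_snd_toReal]
  exact Finset.single_le_sum (f := fun a => (q (a, w.2)).toReal) (fun _ _ => by positivity)
    (Finset.mem_univ w.1)

theorem condProb_le_one (w : α × β) : condProb q w ≤ 1 :=
  div_le_one_of_le₀ (toReal_le_map_snd q w) (by positivity)

theorem condProb_mul (w : α × β) :
    condProb q w * (q.map Prod.snd w.2).toReal = (q w).toReal := by
  unfold condProb
  rcases eq_or_ne ((q.map Prod.snd w.2).toReal) 0 with h | h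
  · have h2 := toReal_le_map_snd q w
    rw [h] at h2
    have : (q w).toReal = 0 := le_antisymm h2 (by positivity)
    rw [this]; simp
  · field_simp

theorem sum_condProb_le_one (b : β) : ∑ a, condProb q (a, b) ≤ 1 := by
  unfold condProb
  dsimp only
  rw [← Finset.sum_div, ← map_snd_toReal]
  exact div_self_le_one _

theorem condProb_pos {w : α × β} (h : 0 < (q w).toReal) : 0 < condProb q w :=
  div_pos h (h.trans_le (toReal_le_map_snd q w))

/-- Conditional entropy is the mean of the conditional information. -/
theorem condEntropy_eq : condEntropy q =
    ∑ w, (q w).toReal * (-Real.logb 2 (condProb q w)) := by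
  unfold condEntropy condProb
  refine Finset.sum_congr rfl fun w _ => ?_
  rw [← Real.logb_inv, inv_div]

theorem info_nonneg (w : α × β) : 0 ≤ -Real.logb 2 (condProb q w) := by
  have := Real.logb_nonpos (b := 2) (by norm_num) (condProb_nonneg q w) (condProb_le_one q w)
  linarith

theorem condEntropy_nonneg : 0 ≤ condEntropy q := by
  rw [condEntropy_eq]
  exact Finset.sum_nonneg fun w _ => mul_nonneg (by positivity) (info_nonneg q w)

theorem prod_condProb {k : ℕ} {w : Fin k → α × β} (h : ∀ i, 0 < (q (w i)).toReal) :
    ∏ i, condProb q (w i) = (2 : ℝ) ^ (-∑ i, -Real.logb 2 (condProb q (w i))) := by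
  rw [Finset.sum_neg_distrib, neg_neg, Real.rpow_sum_of_pos (by norm_num)]
  exact Finset.prod_congr rfl fun i _ =>
    (Real.rpow_logb (by norm_num) (by norm_num) (condProb_pos q (h i))).symm

/-- Probabilities of events are monotone, and blocks of probability zero do not matter. -/
theorem sum_filter_le_of_pos {Ω : Type*} [Fintype Ω] {k : ℕ} (p : PMF Ω)
    {S S' : (Fin k → Ω) → Prop} [DecidablePred S] [DecidablePred S']
    (h : ∀ z, (∀ i, 0 < (p (z i)).toReal) → S z → S' z) :
    ∑ z with S z, ∏ i, (p (z i)).toReal ≤ ∑ z with S' z, ∏ i, (p (z i)).toReal := by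
  rw [Finset.sum_filter, Finset.sum_filter]
  refine Finset.sum_le_sum fun z _ => ?_
  by_cases hz : ∀ i, 0 < (p (z i)).toReal
  · split_ifs with h1 h2 h2
    · exact le_rfl
    · exact absurd (h z hz h1) h2
    · positivity
    · exact le_rfl
  · push Not at hz
    obtain ⟨i, hi⟩ := hz
    have : ∏ i, (p (z i)).toReal = 0 :=
      Finset.prod_eq_zero (Finset.mem_univ i) (le_antisymm hi (by positivity))
    simp [this]

open scoped Classical in
/-- The lower half of the asymptotic equipartition property. The slack is proportional to the
entropy, so that there is none if the entropy vanishes. -/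
theorem aep_lower {θ η : ℝ} (hθ : 0 < θ) (hη : 0 < η) :
    ∃ N : ℕ, ∀ k ≥ N,
      ∑ w : Fin k → α × β with
        ¬ (2 : ℝ) ^ (-(k * (condEntropy q * (1 + θ)))) ≤ ∏ i, condProb q (w i),
          ∏ i, (q (w i)).toReal ≤ η := by
  rcases (condEntropy_nonneg q).eq_or_lt with h0 | hpos
  · refine ⟨0, fun k _ => ?_⟩
    refine le_trans (le_of_eq (Finset.sum_eq_zero fun w hw => ?_)) hη.le
    rw [Finset.mem_filter, ← h0] at hw
    by_contra hne
    apply hw.2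
    have hq : ∀ i, 0 < (q (w i)).toReal := fun i => by
      refine lt_of_le_of_ne (by positivity) fun h => hne ?_
      exact Finset.prod_eq_zero (Finset.mem_univ i) h.symm
    rw [prod_condProb q hq]
    have hall : ∀ i, -Real.logb 2 (condProb q (w i)) = 0 := by
      intro i
      rw [condEntropy_eq, eq_comm, Finset.sum_eq_zero_iff_of_nonneg
        (fun w _ => mul_nonneg (by positivity) (info_nonneg q w))] at h0
      exact (mul_eq_zero.1 (h0 (w i) (Finset.mem_univ _))).resolve_left (hq i).ne'
    simp [hall]
  · obtain ⟨N, hN⟩ := weak_law (fun w => ENNReal.toReal_nonneg) (pmf_sum_toReal q)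
      (fun w => -Real.logb 2 (condProb q w)) (mul_pos hpos hθ) hη
    refine ⟨N, fun k hk => (sum_filter_le_of_pos q fun w hw h => ?_).trans (hN k hk)⟩
    rw [prod_condProb q hw, Real.rpow_le_rpow_left_iff (by norm_num), not_le] at h
    rw [← condEntropy_eq]
    refine lt_of_lt_of_le ?_ (le_abs_self _)
    linarith

open scoped Classical in
/-- The upper half of the asymptotic equipartition property. -/
theorem aep_upper {δ η : ℝ} (hδ : 0 < δ) (hη : 0 < η) :
    ∃ N : ℕ, ∀ k ≥ N,
      ∑ w : Fin k → α × β with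
        ¬ ∏ i, condProb q (w i) ≤ (2 : ℝ) ^ (-(k * (condEntropy q - δ))),
          ∏ i, (q (w i)).toReal ≤ η := by
  obtain ⟨N, hN⟩ := weak_law (fun w => ENNReal.toReal_nonneg) (pmf_sum_toReal q)
    (fun w => -Real.logb 2 (condProb q w)) hδ hη
  refine ⟨N, fun k hk => (sum_filter_le_of_pos q fun w hw h => ?_).trans (hN k hk)⟩
  rw [prod_condProb q hw, Real.rpow_le_rpow_left_iff (by norm_num), not_le] at h
  rw [← condEntropy_eq]
  refine lt_of_lt_of_le ?_ (neg_le_abs _)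
  linarith

open scoped Classical in
/-- For given side information, at most `2 ^ r` blocks have conditional probability at least
`2 ^ (-r)`. -/
theorem card_typical_le {k : ℕ} (r : ℝ) (ys : Fin k → β) :
    ((Finset.univ.filter fun xs : Fin k → α =>
      (2 : ℝ) ^ (-r) ≤ ∏ i, condProb q (xs i, ys i)).card : ℝ) ≤ 2 ^ r := by
  have h1 : ∑ xs : Fin k → α, ∏ i, condProb q (xs i, ys i) ≤ 1 := by
    rw [sum_pi_prod (fun i x => condProb q (x, ys i))]
    exact Finset.prod_le_one (fun i _ => Finset.sum_nonneg fun _ _ => condProb_nonneg q _)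
      fun i _ => sum_condProb_le_one q _
  set A := Finset.univ.filter fun xs : Fin k → α =>
    (2 : ℝ) ^ (-r) ≤ ∏ i, condProb q (xs i, ys i) with hA
  have h2 : (A.card : ℝ) * 2 ^ (-r) ≤ 1 := by
    have h3 : ∑ _xs ∈ A, (2 : ℝ) ^ (-r) ≤ ∑ xs ∈ A, ∏ i, condProb q (xs i, ys i) :=
      Finset.sum_le_sum fun xs hxs => (Finset.mem_filter.1 hxs).2
    rw [Finset.sum_const, nsmul_eq_mul] at h3
    exact (h3.trans (Finset.sum_le_sum_of_subset_of_nonneg (Finset.filter_subset _ _)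
      fun _ _ _ => Finset.prod_nonneg fun _ _ => condProb_nonneg q _)).trans h1
  rw [Real.rpow_neg (by norm_num), ← div_eq_mul_inv, div_le_one (by positivity)] at h2
  exact h2

open scoped Classical in
/-- Source coding with side information `ys` at the encoder and at the decoder: about `k H(A|B)`
bits suffice, and none at all if `H(A|B) = 0`. -/
theorem exists_source_code {θ η : ℝ} (hθ : 0 < θ) (hη : 0 < η) :
    ∃ N : ℕ, ∀ k ≥ N,
      ∃ (enc : (Fin k → α) → (Fin k → β) → Fin (2 ^ ⌈k * (condEntropy q * (1 + θ))⌉₊))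
        (dec : Fin (2 ^ ⌈k * (condEntropy q * (1 + θ))⌉₊) → (Fin k → β) → (Fin k → α)),
        ∑ w : Fin k → α × β with
          ¬ dec (enc (fun i => (w i).1) (fun i => (w i).2)) (fun i => (w i).2) = fun i => (w i).1,
            ∏ i, (q (w i)).toReal ≤ η := by
  obtain ⟨N, hN⟩ := aep_lower q hθ hη
  refine ⟨N, fun k hk => ?_⟩
  set r := k * (condEntropy q * (1 + θ)) with hr
  let A : (Fin k → β) → Finset (Fin k → α) := fun ys =>
    Finset.univ.filter fun xs => (2 : ℝ) ^ (-r) ≤ ∏ i, condProb q (xs i, ys i)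
  have hA : ∀ ys, (A ys).card ≤ 2 ^ ⌈r⌉₊ := by
    intro ys
    have h : ((A ys).card : ℝ) ≤ 2 ^ (⌈r⌉₊ : ℝ) := (card_typical_le q r ys).trans
      (Real.rpow_le_rpow_of_exponent_le (by norm_num) (Nat.le_ceil r))
    rw [Real.rpow_natCast] at h
    exact_mod_cast h
  have hz : 0 < 2 ^ ⌈r⌉₊ := by positivity
  have hα : Nonempty α := ⟨q.support_nonempty.some.1⟩
  have hcode : ∀ ys, ∃ (e : (Fin k → α) → Fin (2 ^ ⌈r⌉₊)) (d : Fin (2 ^ ⌈r⌉₊) → (Fin k → α)),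
      ∀ xs ∈ A ys, d (e xs) = xs := by
    intro ys
    obtain ⟨emb⟩ : Nonempty (A ys ↪ Fin (2 ^ ⌈r⌉₊)) :=
      Function.Embedding.nonempty_of_card_le (by simpa using hA ys)
    refine ⟨fun xs => if h : xs ∈ A ys then emb ⟨xs, h⟩ else ⟨0, hz⟩,
      Function.extend emb Subtype.val fun _ _ => Classical.arbitrary α, fun xs hxs => ?_⟩
    dsimp only
    rw [dif_pos hxs, emb.injective.extend_apply]
  choose e d hd using hcode
  refine ⟨fun xs ys => e ys xs, fun j ys => d ys j, (sum_filter_le_of_pos q ?_).trans (hN k hk)⟩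
  intro w _ hw h
  exact hw (hd _ _ (Finset.mem_filter.2 ⟨Finset.mem_univ _, h⟩))

open scoped Classical in
/-- Converse of source coding with side information at the decoder: a decoder that distinguishes
`a` codewords is correct with probability at most about `a 2 ^ (-k H(A|B))`. -/
theorem source_code_converse {δ η : ℝ} (hδ : 0 < δ) (hη : 0 < η) :
    ∃ N : ℕ, ∀ k ≥ N, ∀ (a : ℕ) (dec : Fin a → (Fin k → β) → (Fin k → α)),
      ∑ w : Fin k → α × β with ∃ j, dec j (fun i => (w i).2) = fun i => (w i).1,
        ∏ i, (q (w i)).toReal ≤ η + a * (2 : ℝ) ^ (-(k * (condEntropy q - δ))) := by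
  obtain ⟨N, hN⟩ := aep_upper q hδ hη
  refine ⟨N, fun k hk a dec => ?_⟩
  set B := (2 : ℝ) ^ (-(k * (condEntropy q - δ))) with hB
  have hB0 : 0 ≤ B := by positivity
  let Q : (Fin k → β) → ℝ := fun ys => ∏ i, (q.map Prod.snd (ys i)).toReal
  have hQ0 : ∀ ys, 0 ≤ Q ys := fun ys => by positivity
  have hQ1 : ∑ ys, Q ys = 1 := sum_pi_prod_eq_one (pmf_sum_toReal _)
  have hq : ∀ w : Fin k → α × β,
      ∏ i, (q (w i)).toReal = (∏ i, condProb q (w i)) * Q fun i => (w i).2 := by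
    intro w
    rw [← Finset.prod_mul_distrib]
    exact Finset.prod_congr rfl fun i _ => (condProb_mul q _).symm
  have hsplit : ∀ w : Fin k → α × β,
      (if ∃ j, dec j (fun i => (w i).2) = fun i => (w i).1 then ∏ i, (q (w i)).toReal else 0) ≤
      (if ¬ ∏ i, condProb q (w i) ≤ B then ∏ i, (q (w i)).toReal else 0) +
      ∑ j, if dec j (fun i => (w i).2) = fun i => (w i).1 then B * Q (fun i => (w i).2) else 0 := by
    intro w
    have hs : 0 ≤ ∑ j, if dec j (fun i => (w i).2) = fun i => (w i).1 then
        B * Q (fun i => (w i).2) else 0 :=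
      Finset.sum_nonneg fun j _ => by
        split_ifs <;> first | exact mul_nonneg hB0 (hQ0 _) | exact le_rfl
    have hp : 0 ≤ ∏ i, (q (w i)).toReal := by positivity
    by_cases h : ∃ j, dec j (fun i => (w i).2) = fun i => (w i).1
    · rw [if_pos h]
      by_cases hc : ∏ i, condProb q (w i) ≤ B
      · rw [if_neg (not_not.2 hc), zero_add]
        obtain ⟨j, hj⟩ := h
        refine le_trans ?_ (Finset.single_le_sum (fun j _ => ?_) (Finset.mem_univ j))
        · rw [if_pos hj, hq]
          exact mul_le_mul_of_nonneg_right hc (hQ0 _)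
        · split_ifs <;> first | exact mul_nonneg hB0 (hQ0 _) | exact le_rfl
      · rw [if_pos hc]; linarith
    · rw [if_neg h]
      split_ifs <;> linarith
  rw [Finset.sum_filter]
  refine (Finset.sum_le_sum fun w _ => hsplit w).trans ?_
  rw [Finset.sum_add_distrib, ← Finset.sum_filter]
  refine add_le_add (hN k hk) (le_of_eq ?_)
  rw [Finset.sum_comm]
  have hj : ∀ j : Fin a, (∑ w : Fin k → α × β,
      if dec j (fun i => (w i).2) = fun i => (w i).1 then B * Q (fun i => (w i).2) else 0) = B := by
    intro j
    rw [← (Equiv.arrowProdEquivProdArrow (Fin k) (fun _ => α) (fun _ => β)).symm.sum_comp,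
      Fintype.sum_prod_type_right]
    simp only [Equiv.arrowProdEquivProdArrow, Equiv.coe_fn_symm_mk]
    calc ∑ y : Fin k → β, ∑ x : Fin k → α,
          (if (dec j fun i => y i) = fun i => x i then B * Q (fun i => y i) else 0)
        = ∑ y : Fin k → β, B * Q y := Finset.sum_congr rfl fun y _ =>
          Fintype.sum_ite_eq (dec j y) fun _ => B * Q y
      _ = B := by rw [← Finset.mul_sum, hQ1, mul_one]
  simp [hj]

end

/-- Entropy is conditional entropy given nothing. -/
theorem entropy_map_eq_condEntropy {Ω Γ : Type*} [Fintype Γ] (p : PMF Ω) (h : Ω → Γ) :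
    entropy (p.map h) = condEntropy (p.map fun z => (h z, ())) := by
  have hsnd : (p.map fun z => (h z, ())).map Prod.snd = PMF.pure () := by
    ext; simp [PMF.map_comp, Function.comp_def]
  have hfst : ∀ c, p.map (fun z => (h z, ())) (c, ()) = p.map h c := by
    intro c
    rw [PMF.map_apply, PMF.map_apply]
    refine tsum_congr fun z => ?_
    by_cases e : c = h z
    · rw [if_pos e, if_pos (congrArg (fun c => (c, ())) e)]
    · rw [if_neg e, if_neg fun e' => e (congrArg Prod.fst e')]
  unfold entropy condEntropy
  rw [hsnd, Fintype.sum_prod_type]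
  simp [hfst]

/-! ### Random linear network codes on unit-capacity edges -/

namespace LinearNetwork

variable {V I S : Type*} [Fintype I] [Fintype S]

/-- What can be seen at the vertex `v`: the bits carried by the edges into `v` and the source bits
available at `v`; `loc s v` says that the source bit `s` is available at `v`. -/
def Visible (head : I → V) (loc : S → V → Prop) (v : V) : I ⊕ S → Prop
  | .inl i => head i = v
  | .inr s => loc s v

open scoped Classical in
/-- The linear combination, with coefficients `m`, of the bits `val` visible at `v`. -/
noncomputable def combine (head : I → V) (loc : S → V → Prop) (v : V) (m val : I ⊕ S → ZMod 2) :
    ZMod 2 :=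
  ∑ z with Visible head loc v z, m z * val z

theorem combine_congr {head : I → V} {loc : S → V → Prop} {v : V} {m val val' : I ⊕ S → ZMod 2}
    (h : ∀ z, Visible head loc v z → val z = val' z) :
    combine head loc v m val = combine head loc v m val' := by
  classical
  exact Finset.sum_congr rfl fun z hz => by rw [h z (Finset.mem_filter.1 hz).2]

variable (tail head : I → V) (loc : S → V → Prop)
  (wf : WellFounded fun i j : I => head i = tail j)

open scoped Classical in
/-- The bits on the edges under the linear code with coefficients `M` for the source bits `w`,
when only the edges inside the vertex set `U` are used, and the others carry `0`. Edge `i` carries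
the combination with coefficients `M i` of the bits visible at its tail. -/
noncomputable def signal (M : I → I ⊕ S → ZMod 2) (w : S → ZMod 2) (U : Set V) : I → ZMod 2 :=
  wf.fix fun i x => if tail i ∈ U ∧ head i ∈ U then
    combine head loc (tail i) (M i) (Sum.elim (fun j => if h : head j = tail i then x j h else 0) w)
    else 0

open scoped Classical in
theorem signal_eq (M : I → I ⊕ S → ZMod 2) (w : S → ZMod 2) (U : Set V) (i : I) :
    signal tail head loc wf M w U i = if tail i ∈ U ∧ head i ∈ U then
      combine head loc (tail i) (M i) (Sum.elim (signal tail head loc wf M w U) w) else 0 := by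
  rw [signal, wf.fix_eq]
  refine if_congr Iff.rfl (combine_congr ?_) rfl
  rintro (j | s) hz
  · have hj : head j = tail i := hz
    simp only [Sum.elim_inl, dif_pos hj]
  · rfl

open scoped Classical in
/-- The recursion along the edges has only one solution. -/
theorem signal_unique {M : I → I ⊕ S → ZMod 2} {w : S → ZMod 2} {U : Set V} {x : I → ZMod 2}
    (h : ∀ i, x i = if tail i ∈ U ∧ head i ∈ U then
      combine head loc (tail i) (M i) (Sum.elim x w) else 0) :
    x = signal tail head loc wf M w U := by
  funext i
  induction i using wf.induction with
  | _ i ih =>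
    rw [h, signal_eq]
    refine if_congr Iff.rfl (combine_congr ?_) rfl
    rintro (j | s) hz
    · exact ih j hz
    · rfl

theorem signal_sub (M : I → I ⊕ S → ZMod 2) (w w' : S → ZMod 2) (U : Set V) :
    signal tail head loc wf M w U - signal tail head loc wf M w' U =
      signal tail head loc wf M (w - w') U := by
  classical
  refine signal_unique tail head loc wf fun i => ?_
  rw [Pi.sub_apply, signal_eq tail head loc wf M w, signal_eq tail head loc wf M w']
  split_ifs
  · unfold combine
    rw [← Finset.sum_sub_distrib]
    refine Finset.sum_congr rfl fun z _ => ?_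
    rcases z with j | s <;> simp [mul_sub]
  · simp

/-- The signal inside `U` depends on the coefficients of the edges inside `U` only. -/
theorem signal_congr {M M' : I → I ⊕ S → ZMod 2} {w : S → ZMod 2} {U : Set V}
    (h : ∀ i, tail i ∈ U → head i ∈ U → M i = M' i) :
    signal tail head loc wf M w U = signal tail head loc wf M' w U := by
  classical
  refine signal_unique tail head loc wf fun i => ?_
  rw [signal_eq]
  split_ifs with hi
  · rw [h i hi.1 hi.2]
  · rfl

/-- The edges out of `U` see something but all carry `0`. -/
def Blocked (M : I → I ⊕ S → ZMod 2) (w : S → ZMod 2) (U : Set V) : Prop :=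
  ∀ i, tail i ∈ U → head i ∉ U →
    (∃ z, Visible head loc (tail i) z ∧ Sum.elim (signal tail head loc wf M w U) w z ≠ 0) ∧
    combine head loc (tail i) (M i) (Sum.elim (signal tail head loc wf M w U) w) = 0

open scoped Classical in
/-- A proportion of at most `2 ^ (-|∂U|)` of all linear codes is blocked at `∂U`: the combinations
on the edges out of `U` can be changed at will without changing the signal inside `U`. -/
theorem card_blocked_mul_le (w : S → ZMod 2) (U : Set V) :
    (Finset.univ.filter fun M => Blocked tail head loc wf M w U).card *
        2 ^ (Finset.univ.filter fun i => tail i ∈ U ∧ head i ∉ U).card ≤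
      Fintype.card (I → I ⊕ S → ZMod 2) := by
  -- coefficients which combine the bits visible at a vertex to `1`, if they are not all zero
  have hν : ∀ (val : I ⊕ S → ZMod 2) (v : V), ∃ ν : I ⊕ S → ZMod 2,
      (∃ z, Visible head loc v z ∧ val z ≠ 0) → combine head loc v ν val = 1 := by
    intro val v
    by_cases h : ∃ z, Visible head loc v z ∧ val z ≠ 0
    · obtain ⟨z, hz, hne⟩ := h
      refine ⟨Pi.single z 1, fun _ => ?_⟩
      have h1 : val z = 1 := by
        have : ∀ b : ZMod 2, b ≠ 0 → b = 1 := by decide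
        exact this _ hne
      unfold combine
      rw [Finset.sum_eq_single z]
      · simp [h1]
      · intro y _ hy; simp [hy]
      · intro hn; exact absurd (Finset.mem_filter.2 ⟨Finset.mem_univ _, hz⟩) hn
    · exact ⟨0, fun h' => absurd h' h⟩
  choose ν hν using hν
  let B := {M : I → I ⊕ S → ZMod 2 // Blocked tail head loc wf M w U}
  let D := {i : I // tail i ∈ U ∧ head i ∉ U}
  let val : (I → I ⊕ S → ZMod 2) → I ⊕ S → ZMod 2 :=
    fun M => Sum.elim (signal tail head loc wf M w U) w
  let shift : B × (D → ZMod 2) → (I → I ⊕ S → ZMod 2) := fun q i =>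
    if h : tail i ∈ U ∧ head i ∉ U then
      q.1.1 i + fun z => q.2 ⟨i, h⟩ * ν (val q.1.1) (tail i) z
    else q.1.1 i
  have hval : ∀ q, val (shift q) = val q.1.1 := by
    intro q
    have : signal tail head loc wf (shift q) w U = signal tail head loc wf q.1.1 w U :=
      signal_congr tail head loc wf fun i _ h2 => dif_neg fun h => h.2 h2
    simp only [val, this]
  have hcomb : ∀ (q : B × (D → ZMod 2)) (i : D),
      combine head loc (tail i) (shift q i) (val q.1.1) = q.2 i := by
    intro q i
    obtain ⟨h1, h2⟩ := q.1.2 i.1 i.2.1 i.2.2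
    have h3 := hν (val q.1.1) (tail i) h1
    have : combine head loc (tail i) (shift q i) (val q.1.1) =
        combine head loc (tail i) (q.1.1 i) (val q.1.1) +
          q.2 i * combine head loc (tail i) (ν (val q.1.1) (tail i)) (val q.1.1) := by
      unfold combine
      rw [Finset.mul_sum, ← Finset.sum_add_distrib]
      refine Finset.sum_congr rfl fun z _ => ?_
      simp only [shift, dif_pos i.2, Pi.add_apply]
      ring
    rw [this, h3, h2, zero_add, mul_one]
  have hinj : Function.Injective shift := by
    intro q q' h
    have hv : val q.1.1 = val q'.1.1 := by rw [← hval, h, hval]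
    have hy : q.2 = q'.2 := by
      funext i
      rw [← hcomb q i, ← hcomb q' i, h, hv]
    have hM : q.1 = q'.1 := by
      apply Subtype.ext
      funext i
      have hi := congrFun h i
      simp only [shift, hv, hy] at hi
      split_ifs at hi
      · exact add_right_cancel hi
      · exact hi
    exact Prod.ext hM hy
  have hcard := Fintype.card_le_of_injective shift hinj
  rw [Fintype.card_prod, Fintype.card_fun, ZMod.card, Fintype.card_subtype,
    Fintype.card_subtype] at hcard
  exact hcard

/-- If the terminal `t` sees only zeros, then the code is blocked at the set `U` of the vertices
that see something else. -/
theorem exists_blocked {M : I → I ⊕ S → ZMod 2} {w : S → ZMod 2} {t : V}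
    (ht : ∀ z, Visible head loc t z →
      Sum.elim (signal tail head loc wf M w Set.univ) w z = 0) :
    ∃ U : Set V, t ∉ U ∧ (∀ s v, w s ≠ 0 → loc s v → v ∈ U) ∧ Blocked tail head loc wf M w U := by
  classical
  set x := signal tail head loc wf M w Set.univ with hx
  have hxi : ∀ i, x i = combine head loc (tail i) (M i) (Sum.elim x w) := by
    intro i; rw [hx, signal_eq]; simp
  let U : Set V := {v | ∃ z, Visible head loc v z ∧ Sum.elim x w z ≠ 0}
  have hhead : ∀ i, head i ∉ U → x i = 0 := by
    intro i hi
    by_contra hne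
    exact hi ⟨.inl i, rfl, hne⟩
  have hU : x = signal tail head loc wf M w U := by
    refine signal_unique tail head loc wf fun i => ?_
    split_ifs with h
    · exact hxi i
    · rw [not_and_or] at h
      rcases h with h | h
      · rw [hxi]
        refine Finset.sum_eq_zero fun z hz => ?_
        by_cases hz0 : Sum.elim x w z = 0
        · rw [hz0, mul_zero]
        · exact absurd ⟨z, (Finset.mem_filter.1 hz).2, hz0⟩ h
      · exact hhead i h
  refine ⟨U, fun ⟨z, hz, hne⟩ => hne (ht z hz), fun s v hs hl => ⟨.inr s, hl, hs⟩, ?_⟩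
  intro i h1 h2
  rw [← hU, ← hxi]
  exact ⟨h1, hhead i h2⟩

open scoped Classical in
/-- Union bound over the nonzero source strings `w`, the terminals, and the cuts that separate them:
if the expected number of failures is less than one, then some linear code lets every terminal
distinguish every `w ≠ 0` from `0`, and hence, by linearity, any two source strings. -/
theorem exists_code [Fintype V] (T : Finset V)
    (hcut : ∑ w : S → ZMod 2 with w ≠ 0, ∑ t ∈ T,
      ∑ U : Finset V with t ∉ U ∧ ∀ s v, w s ≠ 0 → loc s v → v ∈ U,
        ((2 : ℝ) ^ (Finset.univ.filter fun i => tail i ∈ U ∧ head i ∉ U).card)⁻¹ < 1) :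
    ∃ M : I → I ⊕ S → ZMod 2, ∀ w ≠ 0, ∀ t ∈ T, ∃ z, Visible head loc t z ∧
      Sum.elim (signal tail head loc wf M w Set.univ) w z ≠ 0 := by
  by_contra! hbad
  set A : ℝ := ((Fintype.card (I → I ⊕ S → ZMod 2) : ℕ) : ℝ) with hA
  have hApos : 0 < A := by
    rw [hA]; exact_mod_cast Fintype.card_pos
  let bl : (S → ZMod 2) → Finset V → Finset (I → I ⊕ S → ZMod 2) := fun w U =>
    Finset.univ.filter fun M => Blocked tail head loc wf M w (U : Set V)
  let F : (S → ZMod 2) → V → Finset (Finset V) := fun w t =>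
    Finset.univ.filter fun U => t ∉ U ∧ ∀ s v, w s ≠ 0 → loc s v → v ∈ U
  let W : Finset (S → ZMod 2) := Finset.univ.filter fun w => w ≠ 0
  have hcover : (Finset.univ : Finset (I → I ⊕ S → ZMod 2)) ⊆
      W.biUnion fun w => T.biUnion fun t => (F w t).biUnion fun U => bl w U := by
    intro M _
    obtain ⟨w, hw, t, ht, h⟩ := hbad M
    obtain ⟨U, hU1, hU2, hU3⟩ := exists_blocked tail head loc wf h
    simp only [Finset.mem_biUnion, W, F, bl, Finset.mem_filter, Finset.mem_univ, true_and]
    refine ⟨w, hw, t, ht, U.toFinset, ⟨by simpa using hU1, fun s v h1 h2 => ?_⟩, by simpa using hU3⟩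
    simpa using hU2 s v h1 h2
  have hbl : ∀ w U, ((bl w U).card : ℝ) ≤
      A * ((2 : ℝ) ^ (Finset.univ.filter fun i => tail i ∈ U ∧ head i ∉ U).card)⁻¹ := by
    intro w U
    rw [← div_eq_mul_inv, le_div_iff₀ (by positivity)]
    have := card_blocked_mul_le tail head loc wf w (U : Set V)
    simp only [Finset.mem_coe] at this
    rw [hA]
    exact_mod_cast this
  have hle : A ≤ A * ∑ w ∈ W, ∑ t ∈ T, ∑ U ∈ F w t,
      ((2 : ℝ) ^ (Finset.univ.filter fun i => tail i ∈ U ∧ head i ∉ U).card)⁻¹ := by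
    have h1 : Fintype.card (I → I ⊕ S → ZMod 2) ≤
        ∑ w ∈ W, ∑ t ∈ T, ∑ U ∈ F w t, (bl w U).card := by
      rw [← Finset.card_univ]
      refine (Finset.card_le_card hcover).trans (Finset.card_biUnion_le.trans
        (Finset.sum_le_sum fun w _ => Finset.card_biUnion_le.trans
          (Finset.sum_le_sum fun t _ => Finset.card_biUnion_le)))
    have h2 : A ≤ ∑ w ∈ W, ∑ t ∈ T, ∑ U ∈ F w t, ((bl w U).card : ℝ) := by
      rw [hA]; exact_mod_cast h1
    refine h2.trans ?_
    simp_rw [Finset.mul_sum]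
    exact Finset.sum_le_sum fun w _ => Finset.sum_le_sum fun t _ => Finset.sum_le_sum fun U _ =>
      hbl w U
  have : A * ∑ w ∈ W, ∑ t ∈ T, ∑ U ∈ F w t,
      ((2 : ℝ) ^ (Finset.univ.filter fun i => tail i ∈ U ∧ head i ∉ U).card)⁻¹ < A * 1 :=
    mul_lt_mul_of_pos_left hcut hApos
  linarith

end LinearNetwork

/-! ### Network codes for the three latent sources -/

namespace LinearNetwork

variable {V E : Type*}

/-- The vertices at which the bits of the latent sources `X'`, `Y'`, `K` enter the network: the
infinite-capacity edges make the bits of `K` available at both sources. -/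
def latentLoc (sx sy : V) {la lb lc : ℕ} : Fin la ⊕ Fin lb ⊕ Fin lc → V → Prop
  | .inl _, v => v = sx
  | .inr (.inl _), v => v = sy
  | .inr (.inr _), v => v = sx ∨ v = sy

/-- Strings of `l` bits, numbered. -/
noncomputable def bitsEquiv (l : ℕ) : (Fin l → ZMod 2) ≃ Fin (2 ^ l) :=
  Fintype.equivOfCardEq (by simp [ZMod.card])

theorem acyclic_wellFounded [Finite V] {G : Network V E} (hG : G.Acyclic) :
    WellFounded fun e e' : E => G.head e = G.tail e' := by
  let r : V → V → Prop := Relation.TransGen fun u w => ∃ e, G.tail e = u ∧ G.head e = w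
  have hr : Std.Irrefl r := ⟨hG⟩
  have ht : IsTrans V r := ⟨fun _ _ _ => Relation.TransGen.trans⟩
  have wf : WellFounded r := Finite.wellFounded_of_trans_of_irrefl r
  refine Subrelation.wf (r := InvImage r G.tail) ?_ (InvImage.wf _ wf)
  intro e e' h
  exact Relation.TransGen.single ⟨e, rfl, h⟩

variable [Fintype E]

/-- The bits of a triple of messages. -/
noncomputable def messageBits {la lb lc : ℕ}
    (m : (i : Latent) → LatentMessage (2 ^ la) (2 ^ lb) (2 ^ lc) i) :
    Fin la ⊕ Fin lb ⊕ Fin lc → ZMod 2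
  | .inl j => (bitsEquiv la).symm (m .x') j
  | .inr (.inl j) => (bitsEquiv lb).symm (m .y') j
  | .inr (.inr j) => (bitsEquiv lc).symm (m .k) j

theorem messageBits_injective {la lb lc : ℕ} :
    Function.Injective (messageBits (la := la) (lb := lb) (lc := lc)) := by
  intro m m' h
  funext i
  cases i with
  | x' => exact (bitsEquiv la).symm.injective (funext fun j => congrFun h (.inl j))
  | y' => exact (bitsEquiv lb).symm.injective (funext fun j => congrFun h (.inr (.inl j)))
  | k => exact (bitsEquiv lc).symm.injective (funext fun j => congrFun h (.inr (.inr j)))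

theorem messageBits_eq_x' {la lb lc : ℕ}
    {m m' : (i : Latent) → LatentMessage (2 ^ la) (2 ^ lb) (2 ^ lc) i} (h : m .x' = m' .x')
    (j : Fin la) : messageBits m (.inl j) = messageBits m' (.inl j) := by
  simp only [messageBits, h]

theorem messageBits_eq_y' {la lb lc : ℕ}
    {m m' : (i : Latent) → LatentMessage (2 ^ la) (2 ^ lb) (2 ^ lc) i} (h : m .y' = m' .y')
    (j : Fin lb) : messageBits m (.inr (.inl j)) = messageBits m' (.inr (.inl j)) := by
  simp only [messageBits, h]

theorem messageBits_eq_k {la lb lc : ℕ}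
    {m m' : (i : Latent) → LatentMessage (2 ^ la) (2 ^ lb) (2 ^ lc) i} (h : m .k = m' .k)
    (j : Fin lc) : messageBits m (.inr (.inr j)) = messageBits m' (.inr (.inr j)) := by
  simp only [messageBits, h]

/-- A linear code on the network in which each edge `e` is split into `C e` unit-capacity edges
gives a network code on the expanded network, whose infinite-capacity edges carry entire messages. -/
theorem code_of_linear {G : Network V E} {C : E → ℕ} {sx sy : V}
    {T : Finset V} {la lb lc : ℕ}
    (wf : WellFounded fun i j : (Σ e, Fin (C e)) => G.head i.1 = G.tail j.1)
    (M : (Σ e, Fin (C e)) → (Σ e, Fin (C e)) ⊕ (Fin la ⊕ Fin lb ⊕ Fin lc) → ZMod 2)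
    (hM : ∀ w ≠ 0, ∀ t ∈ T, ∃ z,
      Visible (fun i : Σ e, Fin (C e) => G.head i.1) (latentLoc sx sy) t z ∧
      Sum.elim (signal (fun i => G.tail i.1) (fun i => G.head i.1) (latentLoc sx sy) wf M w
        Set.univ) w z ≠ 0) :
    Nonempty ((G.expanded sx sy).Code (expandedCap C) Sum.inr (Sum.inl '' (T : Set V))
      (LatentMessage (2 ^ la) (2 ^ lb) (2 ^ lc))) := by
  classical
  set sig := fun w => signal (fun i : Σ e, Fin (C e) => G.tail i.1) (fun i => G.head i.1)
    (latentLoc sx sy) wf M w Set.univ with hsig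
  let sym : E ⊕ LatentEdge → ((i : Latent) → LatentMessage (2 ^ la) (2 ^ lb) (2 ^ lc) i) → ℕ :=
    fun e m => match e with
    | .inl e => (bitsEquiv (C e) fun j => sig (messageBits m) ⟨e, j⟩).val
    | .inr .x'_x => Fin.val (n := 2 ^ la) (m .x')
    | .inr .y'_y => Fin.val (n := 2 ^ lb) (m .y')
    | .inr .k_x => Fin.val (n := 2 ^ lc) (m .k)
    | .inr .k_y => Fin.val (n := 2 ^ lc) (m .k)
  have key : ∀ v m m', (G.expanded sx sy).view Sum.inr (.inl v) sym m =
      (G.expanded sx sy).view Sum.inr (.inl v) sym m' →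
      ∀ z, Visible (fun i : Σ e, Fin (C e) => G.head i.1) (latentLoc sx sy) v z →
        Sum.elim (sig (messageBits m)) (messageBits m) z =
        Sum.elim (sig (messageBits m')) (messageBits m') z := by
    intro v m m' h z hz
    have h1 : ∀ e, (G.expanded sx sy).head e = .inl v → sym e m = sym e m' :=
      fun e he => congrFun (congrArg Prod.fst h) ⟨e, he⟩
    rcases z with ⟨e, j⟩ | j | j | j
    · have hz' : G.head e = v := hz
      have h2 := h1 (.inl e) (by rw [← hz']; rfl)
      exact congrFun ((bitsEquiv (C e)).injective (Fin.ext h2)) j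
    · have hz' : v = sx := hz
      exact messageBits_eq_x' (Fin.ext (h1 (.inr .x'_x) (by rw [hz']; rfl))) j
    · have hz' : v = sy := hz
      exact messageBits_eq_y' (Fin.ext (h1 (.inr .y'_y) (by rw [hz']; rfl))) j
    · rcases (hz : v = sx ∨ v = sy) with hz' | hz'
      · exact messageBits_eq_k (Fin.ext (h1 (.inr .k_x) (by rw [hz']; rfl))) j
      · exact messageBits_eq_k (Fin.ext (h1 (.inr .k_y) (by rw [hz']; rfl))) j
  refine ⟨⟨sym, ?_, ?_, ?_⟩⟩
  · rintro (e | e) c hc m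
    · have : C e = c := by simpa [expandedCap] using hc
      subst this
      exact Fin.is_lt _
    · exact absurd hc (by simp [expandedCap])
  · rintro (e | e) m m' h
    · have hk := key (G.tail e) m m' h
      refine congrArg Fin.val (congrArg (bitsEquiv (C e)) (funext fun j => ?_))
      simp only [hsig]
      rw [signal_eq, signal_eq]
      rw [if_pos ⟨Set.mem_univ _, Set.mem_univ _⟩, if_pos ⟨Set.mem_univ _, Set.mem_univ _⟩]
      exact combine_congr hk
    · have h2 : ∀ i : Latent, (Sum.inr i : V ⊕ Latent) = (G.expanded sx sy).tail (.inr e) →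
          m i = m' i := fun i hi => congrFun (congrArg Prod.snd h) ⟨i, hi⟩
      cases e with
      | x'_x => exact congrArg Fin.val (h2 .x' rfl)
      | y'_y => exact congrArg Fin.val (h2 .y' rfl)
      | k_x => exact congrArg Fin.val (h2 .k rfl)
      | k_y => exact congrArg Fin.val (h2 .k rfl)
  · rintro _ ⟨t, ht, rfl⟩ m m' h
    have hk := key t m m' h
    by_contra hne
    have hw : messageBits m - messageBits m' ≠ 0 :=
      sub_ne_zero.2 fun hb => hne (messageBits_injective hb)
    obtain ⟨z, hz, hz0⟩ := hM _ hw t ht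
    apply hz0
    rw [← signal_sub]
    have := hk z hz
    rcases z with i | s
    · exact sub_eq_zero.2 this
    · exact sub_eq_zero.2 this

open scoped Classical in
theorem card_unit_edges (G : Network V E) (C : E → ℕ) (U : Finset V) :
    (Finset.univ.filter fun i : Σ e, Fin (C e) => G.tail i.1 ∈ U ∧ G.head i.1 ∉ U).card =
      G.cutValue C U := by
  rw [Finset.card_filter, Fintype.sum_sigma, Network.cutValue, Finset.sum_filter]
  refine Finset.sum_congr rfl fun e _ => ?_
  by_cases h : G.tail e ∈ U ∧ G.head e ∉ U <;> simp [h]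

open scoped Classical in
/-- A bound for the probability that `w` is lost at a cut, if `rx`, `ry`, `rs` bound the cuts that
separate the terminals from `sx`, from `sy`, and from both. A nonzero `w` which lives on the bits of
`X'` only has `2 ^ la - 1` possible values, and accordingly for `Y'`. -/
noncomputable def lossBound {la lb lc : ℕ} (rx ry rs : ℝ)
    (w : Fin la ⊕ Fin lb ⊕ Fin lc → ZMod 2) : ℝ :=
  (if la ≠ 0 ∧ ∀ s, w (.inr s) = 0 then (2 : ℝ) ^ (-rx) else 0) +
  (if lb ≠ 0 ∧ (∀ s, w (.inl s) = 0) ∧ ∀ s, w (.inr (.inr s)) = 0 then (2 : ℝ) ^ (-ry) else 0) +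
  (if la + lb + lc ≠ 0 then (2 : ℝ) ^ (-rs) else 0)

theorem lossBound_nonneg {la lb lc : ℕ} (rx ry rs : ℝ)
    (w : Fin la ⊕ Fin lb ⊕ Fin lc → ZMod 2) : 0 ≤ lossBound rx ry rs w := by
  unfold lossBound
  refine add_nonneg (add_nonneg ?_ ?_) ?_ <;> split_ifs <;> positivity

open scoped Classical in
theorem inv_two_pow_cut_le_lossBound {G : Network V E} {C : E → ℕ} {sx sy : V} {T : Finset V}
    {la lb lc : ℕ} {rx ry rs : ℝ}
    (hx : ∀ t ∈ T, ∀ U : Finset V, sx ∈ U → t ∉ U → rx ≤ G.cutValue C U)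
    (hy : ∀ t ∈ T, ∀ U : Finset V, sy ∈ U → t ∉ U → ry ≤ G.cutValue C U)
    (hs : ∀ t ∈ T, ∀ U : Finset V, sx ∈ U → sy ∈ U → t ∉ U → rs ≤ G.cutValue C U)
    {w : Fin la ⊕ Fin lb ⊕ Fin lc → ZMod 2} (hw : w ≠ 0) {t : V} (ht : t ∈ T) {U : Finset V}
    (htU : t ∉ U) (hU : ∀ s v, w s ≠ 0 → latentLoc sx sy s v → v ∈ U) :
    ((2 : ℝ) ^ (Finset.univ.filter fun i : Σ e, Fin (C e) =>
      G.tail i.1 ∈ U ∧ G.head i.1 ∉ U).card)⁻¹ ≤ lossBound rx ry rs w := by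
  have hinv : ∀ (r : ℝ) (N : ℕ), r ≤ N → ((2 : ℝ) ^ N)⁻¹ ≤ (2 : ℝ) ^ (-r) := by
    intro r N h
    rw [← Real.rpow_natCast, ← Real.rpow_neg (by norm_num)]
    exact Real.rpow_le_rpow_of_exponent_le (by norm_num) (neg_le_neg h)
  rw [card_unit_edges]
  have p1 : 0 ≤ (if la ≠ 0 ∧ ∀ s, w (.inr s) = 0 then (2 : ℝ) ^ (-rx) else 0) := by
    split_ifs <;> positivity
  have p2 : 0 ≤ (if lb ≠ 0 ∧ (∀ s, w (.inl s) = 0) ∧ ∀ s, w (.inr (.inr s)) = 0 then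
      (2 : ℝ) ^ (-ry) else 0) := by
    split_ifs <;> positivity
  have p3 : 0 ≤ (if la + lb + lc ≠ 0 then (2 : ℝ) ^ (-rs) else 0) := by
    split_ifs <;> positivity
  by_cases hboth : sx ∈ U ∧ sy ∈ U
  · have hne : la + lb + lc ≠ 0 := by
      intro h0
      obtain ⟨s, _⟩ := Function.ne_iff.1 hw
      rcases s with s | s | s <;> exact absurd s.2 (by omega)
    have := hinv rs _ (hs t ht U hboth.1 hboth.2 htU)
    simp only [lossBound]
    rw [if_pos hne]
    exact this.trans (le_add_of_nonneg_left (add_nonneg p1 p2))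
  have hk : ∀ s, w (.inr (.inr s)) = 0 := by
    intro s
    by_contra h
    exact hboth ⟨hU _ sx h (Or.inl rfl), hU _ sy h (Or.inr rfl)⟩
  by_cases hxU : sx ∈ U
  · have hyz : ∀ s, w (.inr (.inl s)) = 0 := by
      intro s
      by_contra h
      exact hboth ⟨hxU, hU _ sy h rfl⟩
    have hr : ∀ s, w (.inr s) = 0 := by
      rintro (s | s)
      · exact hyz s
      · exact hk s
    have hne : la ≠ 0 := by
      intro h0
      apply hw
      funext s
      rcases s with s | s
      · exact absurd s.2 (by omega)
      · exact hr s
    have := hinv rx _ (hx t ht U hxU htU)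
    simp only [lossBound]
    rw [if_pos ⟨hne, hr⟩]
    exact this.trans ((le_add_of_nonneg_right p2).trans (le_add_of_nonneg_right p3))
  · have hxz : ∀ s, w (.inl s) = 0 := by
      intro s
      by_contra h
      exact hxU (hU _ sx h rfl)
    have hex : ∃ s, w (.inr (.inl s)) ≠ 0 := by
      by_contra! h
      apply hw
      funext s
      rcases s with s | s | s
      · exact hxz s
      · exact h s
      · exact hk s
    obtain ⟨s, hs0⟩ := hex
    have hne : lb ≠ 0 := by have := s.2; omega
    have := hinv ry _ (hy t ht U (hU _ sy hs0 rfl) htU)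
    rw [← if_pos (c := lb ≠ 0 ∧ (∀ s, w (.inl s) = 0) ∧ ∀ s, w (.inr (.inr s)) = 0)
      (t := (2 : ℝ) ^ (-ry)) (e := 0) ⟨hne, hxz, hk⟩] at this
    simp only [lossBound]
    exact this.trans ((le_add_of_nonneg_left p1).trans (le_add_of_nonneg_right p3))

theorem sum_lossBound_le {la lb lc : ℕ} (rx ry rs : ℝ) :
    ∑ w : Fin la ⊕ Fin lb ⊕ Fin lc → ZMod 2, lossBound rx ry rs w ≤
      (if la ≠ 0 then (2 : ℝ) ^ (la - rx) else 0) + (if lb ≠ 0 then (2 : ℝ) ^ (lb - ry) else 0) +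
        (if la + lb + lc ≠ 0 then (2 : ℝ) ^ ((la + lb + lc : ℕ) - rs) else 0) := by
  classical
  have hcx : ((Finset.univ.filter fun w : Fin la ⊕ Fin lb ⊕ Fin lc → ZMod 2 =>
      ∀ s, w (.inr s) = 0).card : ℝ) ≤ 2 ^ (la : ℝ) := by
    rw [Real.rpow_natCast]
    have h : (Finset.univ.filter fun w : Fin la ⊕ Fin lb ⊕ Fin lc → ZMod 2 =>
        ∀ s, w (.inr s) = 0).card ≤ (Finset.univ : Finset (Fin la → ZMod 2)).card := by
      refine Finset.card_le_card_of_injOn (fun w j => w (.inl j)) (fun _ _ => Finset.mem_univ _) ?_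
      intro w hw w' hw' h
      simp only [Finset.coe_filter, Finset.mem_univ, true_and, Set.mem_ofPred_eq] at hw hw'
      funext s
      rcases s with s | s
      · exact congrFun h s
      · rw [hw, hw']
    rw [Finset.card_univ, Fintype.card_fun, ZMod.card, Fintype.card_fin] at h
    exact_mod_cast h
  have hcy : ((Finset.univ.filter fun w : Fin la ⊕ Fin lb ⊕ Fin lc → ZMod 2 =>
      (∀ s, w (.inl s) = 0) ∧ ∀ s, w (.inr (.inr s)) = 0).card : ℝ) ≤ 2 ^ (lb : ℝ) := by
    rw [Real.rpow_natCast]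
    have h : (Finset.univ.filter fun w : Fin la ⊕ Fin lb ⊕ Fin lc → ZMod 2 =>
        (∀ s, w (.inl s) = 0) ∧ ∀ s, w (.inr (.inr s)) = 0).card ≤
        (Finset.univ : Finset (Fin lb → ZMod 2)).card := by
      refine Finset.card_le_card_of_injOn (fun w j => w (.inr (.inl j)))
        (fun _ _ => Finset.mem_univ _) ?_
      intro w hw w' hw' h
      simp only [Finset.coe_filter, Finset.mem_univ, true_and, Set.mem_ofPred_eq] at hw hw'
      funext s
      rcases s with s | s | s
      · rw [hw.1, hw'.1]
      · exact congrFun h s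
      · rw [hw.2, hw'.2]
    rw [Finset.card_univ, Fintype.card_fun, ZMod.card, Fintype.card_fin] at h
    exact_mod_cast h
  simp only [lossBound]
  rw [Finset.sum_add_distrib, Finset.sum_add_distrib]
  refine add_le_add (add_le_add ?_ ?_) ?_
  · by_cases h : la ≠ 0
    · rw [if_pos h, sub_eq_add_neg, Real.rpow_add (by norm_num)]
      simp only [h, not_false_eq_true, true_and, ne_eq]
      rw [← Finset.sum_filter, Finset.sum_const, nsmul_eq_mul]
      exact mul_le_mul_of_nonneg_right hcx (by positivity)
    · simp [h]
  · by_cases h : lb ≠ 0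
    · rw [if_pos h, sub_eq_add_neg, Real.rpow_add (by norm_num)]
      simp only [h, not_false_eq_true, true_and, ne_eq]
      rw [← Finset.sum_filter, Finset.sum_const, nsmul_eq_mul]
      exact mul_le_mul_of_nonneg_right hcy (by positivity)
    · simp [h]
  · by_cases h : la + lb + lc ≠ 0
    · rw [if_pos h, sub_eq_add_neg, Real.rpow_add (by norm_num), Real.rpow_natCast]
      simp only [if_pos h, Finset.sum_const, Finset.card_univ, Fintype.card_fun, ZMod.card,
        Fintype.card_sum, Fintype.card_fin, nsmul_eq_mul, ← add_assoc]
      simp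
    · simp [h]

open scoped Classical in
/-- Three independent messages of `la`, `lb`, `lc` bits can be sent to all terminals if the cuts are
larger than the number of the bits they have to carry, by a margin that makes up for the number of
terminals and of cuts. The margin is needed for sources that do send something only. -/
theorem exists_network_code [Fintype V] {G : Network V E} (hG : G.Acyclic) {C : E → ℕ} {sx sy : V}
    {T : Finset V} {la lb lc : ℕ} {rx ry rs : ℝ}
    (hx : ∀ t ∈ T, ∀ U : Finset V, sx ∈ U → t ∉ U → rx ≤ G.cutValue C U)
    (hy : ∀ t ∈ T, ∀ U : Finset V, sy ∈ U → t ∉ U → ry ≤ G.cutValue C U)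
    (hs : ∀ t ∈ T, ∀ U : Finset V, sx ∈ U → sy ∈ U → t ∉ U → rs ≤ G.cutValue C U)
    (hlt : (T.card : ℝ) * 2 ^ Fintype.card V *
      ((if la ≠ 0 then (2 : ℝ) ^ (la - rx) else 0) + (if lb ≠ 0 then (2 : ℝ) ^ (lb - ry) else 0) +
        (if la + lb + lc ≠ 0 then (2 : ℝ) ^ ((la + lb + lc : ℕ) - rs) else 0)) < 1) :
    Nonempty ((G.expanded sx sy).Code (expandedCap C) Sum.inr (Sum.inl '' (T : Set V))
      (LatentMessage (2 ^ la) (2 ^ lb) (2 ^ lc))) := by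
  have wf : WellFounded fun i j : (Σ e, Fin (C e)) => G.head i.1 = G.tail j.1 :=
    InvImage.wf (fun i : Σ e, Fin (C e) => i.1) (acyclic_wellFounded hG)
  suffices h : ∃ M : (Σ e, Fin (C e)) → (Σ e, Fin (C e)) ⊕ (Fin la ⊕ Fin lb ⊕ Fin lc) → ZMod 2,
      ∀ w ≠ 0, ∀ t ∈ T, ∃ z,
      Visible (fun i : Σ e, Fin (C e) => G.head i.1) (latentLoc sx sy) t z ∧
      Sum.elim (signal (fun i => G.tail i.1) (fun i => G.head i.1) (latentLoc sx sy) wf M w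
        Set.univ) w z ≠ 0 by
    obtain ⟨M, hM⟩ := h
    exact code_of_linear wf M hM
  apply exists_code
  have hfin : ∀ w : Fin la ⊕ Fin lb ⊕ Fin lc → ZMod 2, w ≠ 0 → (∑ t ∈ T, ∑ U : Finset V with
        t ∉ U ∧ ∀ s v, w s ≠ 0 → latentLoc sx sy s v → v ∈ U,
        ((2 : ℝ) ^ (Finset.univ.filter fun i : Σ e, Fin (C e) =>
          G.tail i.1 ∈ U ∧ G.head i.1 ∉ U).card)⁻¹) ≤
      (T.card : ℝ) * 2 ^ Fintype.card V * lossBound rx ry rs w := by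
    intro w hw
    rw [mul_assoc, ← nsmul_eq_mul]
    refine Finset.sum_le_card_nsmul _ _ _ fun t ht => ?_
    refine (Finset.sum_le_card_nsmul _ _ (lossBound rx ry rs w) fun U hU =>
      inv_two_pow_cut_le_lossBound hx hy hs hw ht
        (Finset.mem_filter.1 hU).2.1 (Finset.mem_filter.1 hU).2.2).trans ?_
    rw [nsmul_eq_mul]
    refine mul_le_mul_of_nonneg_right ?_ (lossBound_nonneg rx ry rs w)
    have := Finset.card_le_univ (Finset.univ.filter fun U : Finset V =>
      t ∉ U ∧ ∀ s v, w s ≠ 0 → latentLoc sx sy s v → v ∈ U)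
    rw [Fintype.card_finset] at this
    exact_mod_cast this
  have hall : (∑ w : Fin la ⊕ Fin lb ⊕ Fin lc → ZMod 2 with w ≠ 0, ∑ t ∈ T, ∑ U : Finset V with
      t ∉ U ∧ ∀ s v, w s ≠ 0 → latentLoc sx sy s v → v ∈ U,
      ((2 : ℝ) ^ (Finset.univ.filter fun i : Σ e, Fin (C e) =>
        G.tail i.1 ∈ U ∧ G.head i.1 ∉ U).card)⁻¹) < 1 := by
    refine lt_of_le_of_lt (Finset.sum_le_sum fun w hw => hfin w (Finset.mem_filter.1 hw).2)
      (lt_of_le_of_lt ?_ hlt)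
    calc ∑ w : Fin la ⊕ Fin lb ⊕ Fin lc → ZMod 2 with w ≠ 0,
          (T.card : ℝ) * 2 ^ Fintype.card V * lossBound rx ry rs w
      _ ≤ ∑ w, (T.card : ℝ) * 2 ^ Fintype.card V * lossBound rx ry rs w :=
        Finset.sum_le_sum_of_subset_of_nonneg (Finset.filter_subset _ _)
          fun w _ _ => mul_nonneg (by positivity) (lossBound_nonneg rx ry rs w)
      _ = (T.card : ℝ) * 2 ^ Fintype.card V * ∑ w, lossBound rx ry rs w := by rw [Finset.mul_sum]
      _ ≤ _ := mul_le_mul_of_nonneg_left (sum_lossBound_le rx ry rs) (by positivity)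
  convert hall

end LinearNetwork

/-! ### The cut-set bound -/

section CutSet

variable {V E : Type*} {G : Network V E} {C : E → ℕ} {sx sy : V} {T : Finset V} {M : Latent → Type*}
  (Φ : (G.expanded sx sy).Code (expandedCap C) Sum.inr (Sum.inl '' (T : Set V)) M)
  {U : Finset V} {m m' : (i : Latent) → M i}

theorem latent_sym_eq {e : LatentEdge} {i : Latent}
    (he : (Sum.inr i : V ⊕ Latent) = (G.expanded sx sy).tail (.inr e)) (h : m i = m' i) :
    Φ.sym (.inr e) m = Φ.sym (.inr e) m' := by
  apply Φ.encode
  have hi : ∀ j : Latent, (Sum.inr j : V ⊕ Latent) = (G.expanded sx sy).tail (.inr e) → j = i :=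
    fun j hj => Sum.inr_injective (hj.trans he.symm)
  refine Prod.ext (funext fun ⟨e', he'⟩ => ?_) (funext fun ⟨j, hj⟩ => ?_)
  · exfalso
    rw [← he] at he'
    rcases e' with e' | e'
    · exact absurd he' Sum.inl_ne_inr
    · cases e' <;> exact absurd he' Sum.inl_ne_inr
  · obtain rfl := hi j hj
    exact h

theorem view_eq_of_notMem (hx : sx ∉ U → m .x' = m' .x') (hy : sy ∉ U → m .y' = m' .y')
    (hk : sx ∉ U ∨ sy ∉ U → m .k = m' .k) {v : V} (hv : v ∉ U)
    (h : ∀ e, G.head e = v → Φ.sym (.inl e) m = Φ.sym (.inl e) m') :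
    (G.expanded sx sy).view Sum.inr (.inl v) Φ.sym m =
      (G.expanded sx sy).view Sum.inr (.inl v) Φ.sym m' := by
  refine Prod.ext (funext fun ⟨e', he'⟩ => ?_) (funext fun ⟨j, hj⟩ => absurd hj Sum.inr_ne_inl)
  rcases e' with e | e
  · exact h e (Sum.inl_injective he')
  · cases e with
    | x'_x =>
      obtain rfl : sx = v := Sum.inl_injective he'
      exact latent_sym_eq Φ (i := .x') rfl (hx hv)
    | y'_y =>
      obtain rfl : sy = v := Sum.inl_injective he'
      exact latent_sym_eq Φ (i := .y') rfl (hy hv)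
    | k_x =>
      obtain rfl : sx = v := Sum.inl_injective he'
      exact latent_sym_eq Φ (i := .k) rfl (hk (.inl hv))
    | k_y =>
      obtain rfl : sy = v := Sum.inl_injective he'
      exact latent_sym_eq Φ (i := .k) rfl (hk (.inr hv))

/-- Messages that agree as far as they enter the network outside `U` can be told apart at a terminal
outside `U` only by the symbols on the edges that leave `U`. -/
theorem eq_of_cut_eq (wf : WellFounded fun e e' : E => G.head e = G.tail e')
    (hx : sx ∉ U → m .x' = m' .x') (hy : sy ∉ U → m .y' = m' .y')
    (hk : sx ∉ U ∨ sy ∉ U → m .k = m' .k) {t : V} (ht : t ∈ T) (htU : t ∉ U)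
    (hcut : ∀ e, G.tail e ∈ U → G.head e ∉ U → Φ.sym (.inl e) m = Φ.sym (.inl e) m') :
    m = m' := by
  have hout : ∀ e, G.tail e ∉ U → Φ.sym (.inl e) m = Φ.sym (.inl e) m' := by
    intro e
    induction e using wf.induction with
    | _ e ih =>
      intro he
      apply Φ.encode
      refine view_eq_of_notMem Φ hx hy hk he fun e' he' => ?_
      by_cases h : G.tail e' ∈ U
      · exact hcut e' h (by rw [he']; exact he)
      · exact ih e' he' h
  refine Φ.decode (.inl t) ⟨t, ht, rfl⟩ (view_eq_of_notMem Φ hx hy hk htU fun e he => ?_)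
  by_cases h : G.tail e ∈ U
  · exact hcut e h (by rw [he]; exact htU)
  · exact hout e h

/-- A family of message triples that differ only in messages entering the network inside `U` has at
most as many members as there are combinations of symbols on the edges that leave `U`. -/
theorem card_le_two_pow_cut [Finite V] [Fintype E]
    (Φ : (G.expanded sx sy).Code (expandedCap C) Sum.inr (Sum.inl '' (T : Set V)) M)
    (hG : G.Acyclic) {γ : Type*} [Fintype γ]
    (μ : γ → (i : Latent) → M i) (hμ : Function.Injective μ)
    (hx : sx ∉ U → ∀ j j', μ j .x' = μ j' .x') (hy : sy ∉ U → ∀ j j', μ j .y' = μ j' .y')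
    (hk : sx ∉ U ∨ sy ∉ U → ∀ j j', μ j .k = μ j' .k) {t : V} (ht : t ∈ T) (htU : t ∉ U) :
    Fintype.card γ ≤ 2 ^ G.cutValue C U := by
  classical
  let D := {e : E // G.tail e ∈ U ∧ G.head e ∉ U}
  let f : γ → (e : D) → Fin (2 ^ C e) := fun j e =>
    ⟨Φ.sym (.inl e.1) (μ j), Φ.sym_lt (.inl e.1) (C e.1) rfl (μ j)⟩
  have hf : Function.Injective f := by
    intro j j' h
    refine hμ (eq_of_cut_eq Φ (LinearNetwork.acyclic_wellFounded hG) (fun h => hx h j j')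
      (fun h => hy h j j') (fun h => hk h j j') ht htU fun e h1 h2 => ?_)
    exact congrArg Fin.val (congrFun h ⟨e, h1, h2⟩)
  refine (Fintype.card_le_of_injective f hf).trans (le_of_eq ?_)
  rw [Fintype.card_pi]
  simp only [Fintype.card_fin, Finset.prod_pow_eq_pow_sum]
  rw [Network.cutValue, Finset.sum_subtype (p := fun e => G.tail e ∈ U ∧ G.head e ∉ U)]
  simp

end CutSet

section CutSetLatent

variable {V E : Type*} [Finite V] [Fintype E] {G : Network V E} {C : E → ℕ} {sx sy : V}
  {T : Finset V} {a b c : ℕ} {U : Finset V} {t : V}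

/-- The triple of messages with the given components. -/
def latentTriple (x : Fin a) (y : Fin b) (k : Fin c) : (i : Latent) → LatentMessage a b c i
  | .x' => x
  | .y' => y
  | .k => k

theorem card_x'_le (hG : G.Acyclic)
    (Φ : (G.expanded sx sy).Code (expandedCap C) Sum.inr (Sum.inl '' (T : Set V))
      (LatentMessage a b c)) (y : Fin b) (k : Fin c) (ht : t ∈ T) (hx : sx ∈ U) (htU : t ∉ U) :
    a ≤ 2 ^ G.cutValue C U := by
  have := card_le_two_pow_cut (γ := Fin a) Φ hG (fun x => latentTriple x y k)
    (fun x x' h => congrFun h .x') (fun h => absurd hx h) (fun _ _ _ => rfl) (fun _ _ _ => rfl)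
    ht htU
  simpa using this

theorem card_y'_le (hG : G.Acyclic)
    (Φ : (G.expanded sx sy).Code (expandedCap C) Sum.inr (Sum.inl '' (T : Set V))
      (LatentMessage a b c)) (x : Fin a) (k : Fin c) (ht : t ∈ T) (hy : sy ∈ U) (htU : t ∉ U) :
    b ≤ 2 ^ G.cutValue C U := by
  have := card_le_two_pow_cut (γ := Fin b) Φ hG (fun y => latentTriple x y k)
    (fun y y' h => congrFun h .y') (fun _ _ _ => rfl) (fun h => absurd hy h) (fun _ _ _ => rfl)
    ht htU
  simpa using this

theorem card_triple_le (hG : G.Acyclic)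
    (Φ : (G.expanded sx sy).Code (expandedCap C) Sum.inr (Sum.inl '' (T : Set V))
      (LatentMessage a b c)) (ht : t ∈ T) (hx : sx ∈ U) (hy : sy ∈ U) (htU : t ∉ U) :
    a * b * c ≤ 2 ^ G.cutValue C U := by
  have := card_le_two_pow_cut (γ := (Fin a × Fin b) × Fin c) Φ hG
    (fun q => latentTriple q.1.1 q.1.2 q.2)
    (fun q q' h => Prod.ext (Prod.ext (congrFun h .x') (congrFun h .y')) (congrFun h .k))
    (fun h => absurd hx h) (fun h => absurd hy h)
    (fun h => h.elim (absurd hx) (absurd hy)) ht htU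
  simpa using this

end CutSetLatent

/-! ### Cut conditions and source codes after decomposition -/

/-- A rate is at most the capacity iff it is at most the value of each cut. -/
theorem rateLE_capacity_iff {V E : Type*} [Fintype E] (G : Network V E) (C : E → ℕ)
    (T S : Finset V) (r : ℝ) :
    RateLE r (G.capacity C T S) ↔
      ∀ t ∈ T, ∀ U : Finset V, S ⊆ U → t ∉ U → r ≤ G.cutValue C U := by
  have hcut : ∀ U, ENNReal.ofReal r ≤ ((G.cutValue C U : ℕ∞) : ENNReal) ↔ r ≤ G.cutValue C U := by
    intro U
    rw [ENat.toENNReal_coe, ← ENNReal.ofReal_natCast,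
      ENNReal.ofReal_le_ofReal_iff (Nat.cast_nonneg _)]
  unfold RateLE Network.capacity Network.minCut
  constructor
  · intro h t ht U hS htU
    rw [← hcut]
    exact h.trans (ENat.toENNReal_mono
      ((iInf₂_le t ht).trans (iInf₂_le U ⟨hS, htU⟩)))
  · intro h
    by_cases htop : (⨅ t ∈ T, ⨅ (U : Finset V) (_ : S ⊆ U ∧ t ∉ U), (G.cutValue C U : ℕ∞)) = ⊤
    · rw [htop]; simp
    · obtain ⟨N, hN⟩ := ENat.ne_top_iff_exists.1 htop
      have hle : (⌈r⌉₊ : ℕ∞) ≤ ⨅ t ∈ T, ⨅ (U : Finset V) (_ : S ⊆ U ∧ t ∉ U),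
          (G.cutValue C U : ℕ∞) := by
        refine le_iInf₂ fun t ht => le_iInf₂ fun U hU => ?_
        exact_mod_cast Nat.ceil_le.2 (h t ht U hU.1 hU.2)
      refine le_trans ?_ (ENat.toENNReal_mono hle)
      rw [ENat.toENNReal_coe, ← ENNReal.ofReal_natCast]
      exact ENNReal.ofReal_le_ofReal (Nat.le_ceil r)

theorem cutValue_delayed {V E : Type*} [Fintype E] (G : Network V E) (C : E → ℕ) (n : ℕ)
    (U : Finset V) : G.cutValue (Network.delayed n C) U = n * G.cutValue C U := by
  unfold Network.cutValue Network.delayed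
  rw [Finset.mul_sum]

section
variable {𝒳 𝒴 : Type*} [Fintype 𝒳] [Fintype 𝒴] (p : PMF (𝒳 × 𝒴))

/-- Separate source codes after source decomposition: about `k H(X|K)`, `k H(Y|K)` and `k H(K)` bits
suffice. Both encoders know `K`, as it is a function of `X` and, almost surely, of `Y`. -/
theorem exists_decompositionCode {ε : ℝ} (hε : 0 < ε) :
    ∃ N : ℕ, ∀ k ≥ N,
      ∃ D : DecompositionCode p k (2 ^ ⌈k * (condEntropyXK p * (1 + ε))⌉₊)
        (2 ^ ⌈k * (condEntropyYK p * (1 + ε))⌉₊) (2 ^ ⌈k * (entropyK p * (1 + ε))⌉₊),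
        1 - ε ≤ D.probCorrect := by
  classical
  have hη : 0 < ε / 3 := by positivity
  obtain ⟨N₁, h₁⟩ := exists_source_code (p.map fun z => (z.1, commonInfo p z)) hε hη
  obtain ⟨N₂, h₂⟩ := exists_source_code (p.map fun z => (z.2, commonInfo p z)) hε hη
  obtain ⟨N₃, h₃⟩ := exists_source_code (p.map fun z => (commonInfo p z, ())) hε hη
  refine ⟨max N₁ (max N₂ N₃), fun k hk => ?_⟩
  obtain ⟨e₁, d₁, h₁⟩ := h₁ k (le_trans (le_max_left _ _) hk)
  obtain ⟨e₂, d₂, h₂⟩ := h₂ k (le_trans ((le_max_left _ _).trans (le_max_right _ _)) hk)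
  obtain ⟨e₃, d₃, h₃⟩ := h₃ k (le_trans ((le_max_right _ _).trans (le_max_right _ _)) hk)
  have hK : entropyK p = condEntropy (p.map fun z => (commonInfo p z, ())) :=
    entropy_map_eq_condEntropy p _
  rw [hK]
  let D : DecompositionCode p k (2 ^ ⌈k * (condEntropyXK p * (1 + ε))⌉₊)
      (2 ^ ⌈k * (condEntropyYK p * (1 + ε))⌉₊)
      (2 ^ ⌈k * (condEntropy (p.map fun z => (commonInfo p z, ())) * (1 + ε))⌉₊) :=
    { encX := fun xs => e₁ xs fun i => (bipartiteGraph p).connectedComponentMk (.inl (xs i))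
      encY := fun ys => e₂ ys fun i => (bipartiteGraph p).connectedComponentMk (.inr (ys i))
      encK := fun ks => e₃ ks fun _ => ()
      decK := fun j => d₃ j fun _ => ()
      decX := d₁
      decY := d₂ }
  refine ⟨D, ?_⟩
  replace h₁ := (sum_filter_pi_prod_map p (fun z => (z.1, commonInfo p z))
    (fun w => ¬ d₁ (e₁ (fun i => (w i).1) (fun i => (w i).2)) (fun i => (w i).2) =
      fun i => (w i).1)).le.trans h₁
  replace h₂ := (sum_filter_pi_prod_map p (fun z => (z.2, commonInfo p z))
    (fun w => ¬ d₂ (e₂ (fun i => (w i).1) (fun i => (w i).2)) (fun i => (w i).2) =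
      fun i => (w i).1)).le.trans h₂
  replace h₃ := (sum_filter_pi_prod_map p (fun z => (commonInfo p z, ()))
    (fun w => ¬ d₃ (e₃ (fun i => (w i).1) (fun i => (w i).2)) (fun i => (w i).2) =
      fun i => (w i).1)).le.trans h₃
  dsimp only at h₁ h₂ h₃
  have hone := sum_pi_prod_eq_one (k := k) (pmf_sum_toReal p)
  rw [← Finset.sum_filter_add_sum_filter_not Finset.univ D.Correct] at hone
  have herr : ∑ z : Fin k → 𝒳 × 𝒴 with ¬ D.Correct z, ∏ i, (p (z i)).toReal ≤ ε := by
    refine (sum_filter_le_of_pos p (S' := fun z =>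
      (¬ d₁ (e₁ (fun i => (z i).1) (fun i => commonInfo p (z i))) (fun i => commonInfo p (z i)) =
        fun i => (z i).1) ∨
      (¬ d₂ (e₂ (fun i => (z i).2) (fun i => commonInfo p (z i))) (fun i => commonInfo p (z i)) =
        fun i => (z i).2) ∨
      (¬ d₃ (e₃ (fun i => commonInfo p (z i)) (fun _ => ())) (fun _ => ()) =
        fun i => commonInfo p (z i))) ?_).trans ?_
    · intro z hz hc
      by_contra hgood
      push Not at hgood
      obtain ⟨g₁, g₂, g₃⟩ := hgood
      have hy : (fun i => (bipartiteGraph p).connectedComponentMk (.inr (z i).2)) =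
          fun i => commonInfo p (z i) := by
        funext i
        exact (commonInfo_eq_of_pos p (z i).1 (z i).2 (ENNReal.toReal_pos_iff.1 (hz i)).1).symm
      apply hc
      have gk : D.decK (D.encK fun i => commonInfo p (z i)) = fun i => commonInfo p (z i) := g₃
      refine ⟨gk, ?_, ?_⟩
      · rw [gk]; exact g₁
      · rw [gk]
        change d₂ (e₂ _ fun i => (bipartiteGraph p).connectedComponentMk (.inr (z i).2)) _ = _
        rw [hy]; exact g₂
    · rw [Finset.filter_or, Finset.filter_or]
      have h0 : ∀ z : Fin k → 𝒳 × 𝒴, 0 ≤ ∏ i, (p (z i)).toReal := fun z => by positivity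
      have hun : ∀ A B : Finset (Fin k → 𝒳 × 𝒴), ∑ z ∈ A ∪ B, ∏ i, (p (z i)).toReal ≤
          ∑ z ∈ A, ∏ i, (p (z i)).toReal + ∑ z ∈ B, ∏ i, (p (z i)).toReal := by
        intro A B
        rw [← Finset.sum_union_inter]
        exact le_add_of_nonneg_right (Finset.sum_nonneg fun z _ => h0 z)
      refine (hun _ _).trans ?_
      have := hun
        (Finset.univ.filter fun z : Fin k → 𝒳 × 𝒴 =>
          ¬ d₂ (e₂ (fun i => (z i).2) (fun i => commonInfo p (z i)))
            (fun i => commonInfo p (z i)) = fun i => (z i).2)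
        (Finset.univ.filter fun z : Fin k → 𝒳 × 𝒴 =>
          ¬ d₃ (e₃ (fun i => commonInfo p (z i)) (fun _ => ())) (fun _ => ()) =
            fun i => commonInfo p (z i))
      linarith
  have hc : D.probCorrect = ∑ z : Fin k → 𝒳 × 𝒴 with D.Correct z, ∏ i, (p (z i)).toReal := by
    unfold DecompositionCode.probCorrect
    congr!
  rw [hc]
  linarith

/-- Converse: source codes that are correct with probability at least `1/2` need about `k H(X|K)`,
`k H(Y|K)` and `k H(K)` bits. -/
theorem decompositionCode_converse {δ : ℝ} (hδ : 0 < δ) :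
    ∃ N : ℕ, ∀ k ≥ N, ∀ (a b c : ℕ) (D : DecompositionCode p k a b c), 1 / 2 ≤ D.probCorrect →
      1 / 4 ≤ a * (2 : ℝ) ^ (-(k * (condEntropyXK p - δ))) ∧
      1 / 4 ≤ b * (2 : ℝ) ^ (-(k * (condEntropyYK p - δ))) ∧
      1 / 4 ≤ c * (2 : ℝ) ^ (-(k * (entropyK p - δ))) := by
  classical
  have hη : (0 : ℝ) < 1 / 4 := by norm_num
  obtain ⟨N₁, h₁⟩ := source_code_converse (p.map fun z => (z.1, commonInfo p z)) hδ hη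
  obtain ⟨N₂, h₂⟩ := source_code_converse (p.map fun z => (z.2, commonInfo p z)) hδ hη
  obtain ⟨N₃, h₃⟩ := source_code_converse (p.map fun z => (commonInfo p z, ())) hδ hη
  refine ⟨max N₁ (max N₂ N₃), fun k hk a b c D hD => ?_⟩
  replace h₁ := h₁ k (le_trans (le_max_left _ _) hk) a D.decX
  replace h₂ := h₂ k (le_trans ((le_max_left _ _).trans (le_max_right _ _)) hk) b D.decY
  replace h₃ := h₃ k (le_trans ((le_max_right _ _).trans (le_max_right _ _)) hk) c
    fun j _ => D.decK j
  have hK : entropyK p = condEntropy (p.map fun z => (commonInfo p z, ())) :=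
    entropy_map_eq_condEntropy p _
  rw [hK]
  replace h₁ := (sum_filter_pi_prod_map p (fun z => (z.1, commonInfo p z))
    (fun w => ∃ j, D.decX j (fun i => (w i).2) = fun i => (w i).1)).le.trans h₁
  replace h₂ := (sum_filter_pi_prod_map p (fun z => (z.2, commonInfo p z))
    (fun w => ∃ j, D.decY j (fun i => (w i).2) = fun i => (w i).1)).le.trans h₂
  replace h₃ := (sum_filter_pi_prod_map p (fun z => (commonInfo p z, ()))
    (fun w => ∃ j, D.decK j = fun i => (w i).1)).le.trans h₃
  dsimp only at h₁ h₂ h₃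
  have hc : D.probCorrect = ∑ z : Fin k → 𝒳 × 𝒴 with D.Correct z, ∏ i, (p (z i)).toReal := by
    unfold DecompositionCode.probCorrect
    congr!
  rw [hc] at hD
  have hle : ∀ (S : (Fin k → 𝒳 × 𝒴) → Prop) [DecidablePred S], (∀ z, D.Correct z → S z) →
      1 / 2 ≤ ∑ z with S z, ∏ i, (p (z i)).toReal := fun S _ hS =>
    hD.trans (sum_filter_le_of_pos p fun z _ hz => hS z hz)
  have g₁ := hle (fun z => ∃ j, D.decX j (fun i => commonInfo p (z i)) = fun i => (z i).1)
    fun z hz => ⟨D.encX fun i => (z i).1, by have := hz.2.1; rw [hz.1] at this; exact this⟩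
  have g₂ := hle (fun z => ∃ j, D.decY j (fun i => commonInfo p (z i)) = fun i => (z i).2)
    fun z hz => ⟨D.encY fun i => (z i).2, by have := hz.2.2; rw [hz.1] at this; exact this⟩
  have g₃ := hle (fun z => ∃ j, D.decK j = fun i => commonInfo p (z i))
    fun z hz => ⟨_, hz.1⟩
  unfold condEntropyXK condEntropyYK
  refine ⟨?_, ?_, ?_⟩
  · linarith [g₁.trans h₁]
  · linarith [g₂.trans h₂]
  · linarith [g₃.trans h₃]

end

/-! ### Separation by source decomposition -/

/-- A source of entropy `H` sends `l` bits through cuts of value at least `n H`. As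
`(1 - ε) (1 + ε) < 1`, its slack grows with `n`, unless `H = 0`, when it sends nothing. -/
theorem exists_forall_two_pow_sub_le {H ε B : ℝ} (hH : 0 ≤ H) (hε : 0 < ε) (hB : 0 < B) :
    ∃ N : ℕ, ∀ n ≥ N, ∀ l : ℕ, (H = 0 → l = 0) →
      (l : ℝ) ≤ ((1 - ε) * n + 1) * (H * (1 + ε)) + 3 →
      (if l ≠ 0 then (2 : ℝ) ^ (l - n * H) else 0) ≤ B := by
  rcases hH.eq_or_lt with h0 | hpos
  · refine ⟨0, fun n _ l hl _ => ?_⟩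
    rw [if_neg (not_not.2 (hl h0.symm))]
    exact hB.le
  · obtain ⟨N, hN⟩ := exists_nat_gt ((H * (1 + ε) + 3 - Real.logb 2 B) / (ε ^ 2 * H))
    refine ⟨N, fun n hn l _ hl => ?_⟩
    split_ifs
    · rw [← Real.le_logb_iff_rpow_le (by norm_num) hB]
      have h1 : (H * (1 + ε) + 3 - Real.logb 2 B) / (ε ^ 2 * H) < n :=
        hN.trans_le (by exact_mod_cast hn)
      rw [div_lt_iff₀ (by positivity)] at h1
      nlinarith
    · exact hB.le

/-- If the entropy `H` exceeds the cut value `ρ`, then blocks of length `k ≥ (1 - ε) n` cannot be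
squeezed through `n ρ` bits. -/
theorem exists_forall_mul_rpow_lt {H : ℝ} {ρ : ℕ} (h : (ρ : ℝ) < H) :
    ∃ δ > 0, ∃ ε₀ : ℝ, 0 < ε₀ ∧ ∀ ε : ℝ, 0 < ε → ε < ε₀ → ∀ K : ℕ, ∃ N : ℕ, ∀ n ≥ N, ∀ k : ℕ,
      (1 - ε) * n ≤ k → K ≤ k ∧ ε ≤ 1 / 2 ∧
        (2 : ℝ) ^ (n * ρ) * 2 ^ (-(k * (H - 3 * δ))) < 1 / 64 := by
  have hρ : (0 : ℝ) ≤ ρ := Nat.cast_nonneg _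
  set δ := (H - ρ) / 6 with hδ
  have hδ0 : 0 < δ := by rw [hδ]; linarith
  have hHδ : H - 3 * δ = ρ + 3 * δ := by rw [hδ]; ring
  refine ⟨δ, hδ0, min (1 / 2) (δ / (ρ + 3 * δ)), by positivity, fun ε hε0 hε K => ?_⟩
  have hε2 : ε < 1 / 2 := hε.trans_le (min_le_left _ _)
  have hε3 : ε * (ρ + 3 * δ) < δ := by
    rw [← lt_div_iff₀ (by positivity)]
    exact hε.trans_le (min_le_right _ _)
  obtain ⟨N, hN⟩ := exists_nat_gt (6 / (2 * δ))
  refine ⟨max N (2 * K), fun n hn k hk => ?_⟩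
  have hnK : (2 * K : ℝ) ≤ n := by exact_mod_cast (le_max_right _ _).trans hn
  have hnN : 6 / (2 * δ) < n := hN.trans_le (by exact_mod_cast (le_max_left _ _).trans hn)
  rw [div_lt_iff₀ (by positivity)] at hnN
  have hn0 : (0 : ℝ) ≤ n := Nat.cast_nonneg _
  refine ⟨?_, hε2.le, ?_⟩
  · have : (K : ℝ) ≤ k := by nlinarith
    exact_mod_cast this
  · rw [hHδ, ← Real.rpow_natCast, ← Real.rpow_add (by norm_num)]
    have h64 : (1 / 64 : ℝ) = 2 ^ (-6 : ℝ) := by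
      rw [Real.rpow_neg (by norm_num)]; norm_num
    rw [h64]
    refine Real.rpow_lt_rpow_of_exponent_lt (by norm_num) ?_
    push_cast
    have h1 : (1 - ε) * n * (ρ + 3 * δ) ≤ k * (ρ + 3 * δ) :=
      mul_le_mul_of_nonneg_right hk (by positivity)
    have h2 : n * (ε * (ρ + 3 * δ)) ≤ n * δ := mul_le_mul_of_nonneg_left hε3.le hn0
    nlinarith

section
variable {V E 𝒳 𝒴 : Type*} [Fintype 𝒳] [Fintype 𝒴]
  {G : Network V E} {C : E → ℕ} {sx sy : V} {T : Finset V} {p : PMF (𝒳 × 𝒴)}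

theorem entropyK_nonneg : 0 ≤ entropyK p := by
  unfold entropyK
  rw [entropy_map_eq_condEntropy]
  exact condEntropy_nonneg _

open scoped Classical in
/-- The cut conditions on the three independent latent sources are sufficient. -/
theorem feasibleByDecomposition_of_rateLE [Fintype V] [Fintype E] (hG : G.Acyclic)
    (hx : RateLE (condEntropyXK p) (G.capacity C T {sx}))
    (hy : RateLE (condEntropyYK p) (G.capacity C T {sy}))
    (hs : RateLE (condEntropyXK p + condEntropyYK p + entropyK p) (G.capacity C T {sx, sy}))
    {ε : ℝ} (hε : 0 < ε) (hε1 : ε < 1) :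
    ∃ N : ℕ, ∀ n ≥ N,
      FeasibleByDecomposition G (Network.delayed n C) sx sy T p ε ((1 - ε) * n) := by
  rw [rateLE_capacity_iff] at hx hy hs
  have hX : 0 ≤ condEntropyXK p := condEntropy_nonneg _
  have hY : 0 ≤ condEntropyYK p := condEntropy_nonneg _
  have hK : 0 ≤ entropyK p := entropyK_nonneg
  set X := condEntropyXK p
  set Y := condEntropyYK p
  set K := entropyK p
  obtain ⟨N₀, h₀⟩ := exists_decompositionCode p hε
  set A : ℝ := (T.card : ℝ) * 2 ^ Fintype.card V with hA
  have hA0 : 0 ≤ A := by positivity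
  have hB : 0 < 1 / (4 * (A + 1)) := by positivity
  obtain ⟨N₁, h₁⟩ := exists_forall_two_pow_sub_le hX hε hB
  obtain ⟨N₂, h₂⟩ := exists_forall_two_pow_sub_le hY hε hB
  obtain ⟨N₃, h₃⟩ := exists_forall_two_pow_sub_le (add_nonneg (add_nonneg hX hY) hK) hε hB
  obtain ⟨N₄, h₄⟩ := exists_nat_ge (N₀ / (1 - ε))
  refine ⟨max (max N₁ N₂) (max N₃ N₄), fun n hn => ?_⟩
  have hn₁ : N₁ ≤ n := ((le_max_left _ _).trans (le_max_left _ _)).trans hn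
  have hn₂ : N₂ ≤ n := ((le_max_right _ _).trans (le_max_left _ _)).trans hn
  have hn₃ : N₃ ≤ n := ((le_max_left _ _).trans (le_max_right _ _)).trans hn
  have hn₄ : (N₄ : ℝ) ≤ n := by
    exact_mod_cast ((le_max_right _ _).trans (le_max_right _ _)).trans hn
  have hr0 : 0 ≤ (1 - ε) * n := mul_nonneg (by linarith) (Nat.cast_nonneg _)
  have hk := Nat.le_ceil ((1 - ε) * (n : ℝ))
  have hk1 := (Nat.ceil_lt_add_one hr0).le
  set k := ⌈(1 - ε) * (n : ℝ)⌉₊ with hkdef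
  have hkN : N₀ ≤ k := by
    have h5 := h₄.trans hn₄
    rw [div_le_iff₀ (by linarith)] at h5
    have : (N₀ : ℝ) ≤ k := by linarith
    exact_mod_cast this
  obtain ⟨D, hD⟩ := h₀ k hkN
  refine ⟨k, _, _, _, hk, ⟨D, hD⟩, ?_⟩
  have hbits : ∀ H : ℝ, 0 ≤ H →
      ((⌈k * (H * (1 + ε))⌉₊ : ℕ) : ℝ) ≤ ((1 - ε) * n + 1) * (H * (1 + ε)) + 1 := by
    intro H hH
    have hH' : 0 ≤ H * (1 + ε) := by positivity
    refine (Nat.ceil_lt_add_one (by positivity)).le.trans ?_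
    have := mul_le_mul_of_nonneg_right hk1 hH'
    linarith
  have hzero : ∀ H : ℝ, H = 0 → ⌈k * (H * (1 + ε))⌉₊ = 0 := by
    intro H hH; simp [hH]
  have bX := hbits X hX
  have bY := hbits Y hY
  have bK := hbits K hK
  set la := ⌈k * (X * (1 + ε))⌉₊
  set lb := ⌈k * (Y * (1 + ε))⌉₊
  set lc := ⌈k * (K * (1 + ε))⌉₊
  have t₁ := h₁ n hn₁ la (hzero X) (by linarith)
  have t₂ := h₂ n hn₂ lb (hzero Y) (by linarith)
  have t₃ := h₃ n hn₃ (la + lb + lc)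
    (fun h => by
      have e1 : la = 0 := hzero X (by linarith)
      have e2 : lb = 0 := hzero Y (by linarith)
      have e3 : lc = 0 := hzero K (by linarith)
      omega)
    (by push_cast; linarith)
  refine LinearNetwork.exists_network_code hG (rx := n * X) (ry := n * Y) (rs := n * (X + Y + K))
    ?_ ?_ ?_ ?_
  · intro t ht U h1 h2
    rw [cutValue_delayed, Nat.cast_mul]
    exact mul_le_mul_of_nonneg_left (hx t ht U (by simpa using h1) h2) (Nat.cast_nonneg _)
  · intro t ht U h1 h2
    rw [cutValue_delayed, Nat.cast_mul]
    exact mul_le_mul_of_nonneg_left (hy t ht U (by simpa using h1) h2) (Nat.cast_nonneg _)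
  · intro t ht U h1 h2 h3
    rw [cutValue_delayed, Nat.cast_mul]
    exact mul_le_mul_of_nonneg_left
      (hs t ht U (Finset.insert_subset h1 (by simpa using h2)) h3) (Nat.cast_nonneg _)
  · rw [← hA]
    refine lt_of_le_of_lt
      (mul_le_mul_of_nonneg_left (add_le_add (add_le_add t₁ t₂) t₃) hA0) ?_
    have : A * (1 / (4 * (A + 1)) + 1 / (4 * (A + 1)) + 1 / (4 * (A + 1))) =
        3 * A / (4 * (A + 1)) := by ring
    rw [this, div_lt_one (by positivity)]
    linarith

/-- A lower bound `2 ^ (k H)` on some number of codewords contradicts feasibility when this number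
is at most `2 ^ (n ρ)` with `ρ < H`. -/
theorem not_feasibleByDecomposition {H : ℝ} {ρ : ℕ} (hρ : (ρ : ℝ) < H)
    (hcodes : ∀ δ > 0, ∃ K : ℕ, ∀ k ≥ K, ∀ (n a b c : ℕ) (D : DecompositionCode p k a b c),
      1 / 2 ≤ D.probCorrect →
      Nonempty ((G.expanded sx sy).Code (expandedCap (Network.delayed n C)) Sum.inr
        (Sum.inl '' (T : Set V)) (LatentMessage a b c)) →
      1 / 64 ≤ (2 : ℝ) ^ (n * ρ) * 2 ^ (-(k * (H - 3 * δ)))) :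
    ∃ ε₀ : ℝ, 0 < ε₀ ∧ ∀ ε : ℝ, 0 < ε → ε < ε₀ → ∃ N : ℕ, ∀ n : ℕ, N ≤ n →
      ¬ FeasibleByDecomposition G (Network.delayed n C) sx sy T p ε ((1 - ε) * n) := by
  obtain ⟨δ, hδ, ε₀, hε₀, h⟩ := exists_forall_mul_rpow_lt hρ
  refine ⟨ε₀, hε₀, fun ε h1 h2 => ?_⟩
  obtain ⟨K, hK⟩ := hcodes δ hδ
  obtain ⟨N, hN⟩ := h ε h1 h2 K
  refine ⟨N, fun n hn ⟨k, a, b, c, hk, ⟨D, hD⟩, hΦ⟩ => ?_⟩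
  obtain ⟨hKk, hε2, hlt⟩ := hN n hn k hk
  exact absurd (hK k hKk n a b c D (by linarith) hΦ) (not_le.2 hlt)

open scoped Classical in
/-- The cut conditions on the three independent latent sources are necessary, if the tolerance is
small and the block length large. -/
theorem not_feasibleByDecomposition_of_not_rateLE [Finite V] [Fintype E] (hG : G.Acyclic)
    (h : ¬ (RateLE (condEntropyXK p) (G.capacity C T {sx}) ∧
        RateLE (condEntropyYK p) (G.capacity C T {sy}) ∧
        RateLE (condEntropyXK p + condEntropyYK p + entropyK p) (G.capacity C T {sx, sy}))) :
    ∃ ε₀ : ℝ, 0 < ε₀ ∧ ∀ ε : ℝ, 0 < ε → ε < ε₀ → ∃ N : ℕ, ∀ n : ℕ, N ≤ n →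
      ¬ FeasibleByDecomposition G (Network.delayed n C) sx sy T p ε ((1 - ε) * n) := by
  simp only [rateLE_capacity_iff, not_and_or] at h
  push Not at h
  have hne : Nonempty (𝒳 × 𝒴) := ⟨p.support_nonempty.some⟩
  have htwo : ∀ x : ℝ, (0 : ℝ) < 2 ^ x := fun x => Real.rpow_pos_of_pos (by norm_num) x
  have hcast : ∀ {a n c : ℕ}, a ≤ 2 ^ (n * c) → (a : ℝ) ≤ 2 ^ (n * c) := fun h => by
    exact_mod_cast h
  rcases h with ⟨t, ht, U, hxU, htU, hlt⟩ | ⟨t, ht, U, hyU, htU, hlt⟩ | ⟨t, ht, U, hxyU, htU, hlt⟩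
  -- the fixed codewords of the other two sources are those of a constant block
  · refine not_feasibleByDecomposition hlt fun δ hδ => ?_
    obtain ⟨K, hK⟩ := decompositionCode_converse p (δ := 3 * δ) (by linarith)
    refine ⟨K, fun k hk n a b c D hD ⟨Φ⟩ => ?_⟩
    have hb := card_x'_le hG Φ (D.encY fun _ => hne.some.2)
      (D.encK fun _ => commonInfo p hne.some) ht (by simpa using hxU) htU
    rw [cutValue_delayed] at hb
    have := mul_le_mul_of_nonneg_right (hcast hb)
      (htwo (-(k * (condEntropyXK p - 3 * δ)))).le
    linarith [(hK k hk a b c D hD).1]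
  · refine not_feasibleByDecomposition hlt fun δ hδ => ?_
    obtain ⟨K, hK⟩ := decompositionCode_converse p (δ := 3 * δ) (by linarith)
    refine ⟨K, fun k hk n a b c D hD ⟨Φ⟩ => ?_⟩
    have hb := card_y'_le hG Φ (D.encX fun _ => hne.some.1)
      (D.encK fun _ => commonInfo p hne.some) ht (by simpa using hyU) htU
    rw [cutValue_delayed] at hb
    have := mul_le_mul_of_nonneg_right (hcast hb)
      (htwo (-(k * (condEntropyYK p - 3 * δ)))).le
    linarith [(hK k hk a b c D hD).2.1]
  -- each of the three converses takes a third of the slack `3 δ`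
  · refine not_feasibleByDecomposition hlt fun δ hδ => ?_
    obtain ⟨K, hK⟩ := decompositionCode_converse p hδ
    refine ⟨K, fun k hk n a b c D hD ⟨Φ⟩ => ?_⟩
    have hb := card_triple_le hG Φ ht (hxyU (by simp)) (hxyU (by simp)) htU
    rw [cutValue_delayed] at hb
    obtain ⟨g₁, g₂, g₃⟩ := hK k hk a b c D hD
    have hprod : ((a * b * c : ℕ) : ℝ) *
        2 ^ (-(k * (condEntropyXK p + condEntropyYK p + entropyK p - 3 * δ))) =
        a * (2 : ℝ) ^ (-(k * (condEntropyXK p - δ))) *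
          (b * (2 : ℝ) ^ (-(k * (condEntropyYK p - δ)))) *
          (c * (2 : ℝ) ^ (-(k * (entropyK p - δ)))) := by
      have : -(k * (condEntropyXK p + condEntropyYK p + entropyK p - 3 * δ)) =
          -(k * (condEntropyXK p - δ)) + -(k * (condEntropyYK p - δ)) +
            -(k * (entropyK p - δ)) := by ring
      rw [this, Real.rpow_add (by norm_num), Real.rpow_add (by norm_num)]
      push_cast
      ring
    have h64 : (1 : ℝ) / 64 ≤ ((a * b * c : ℕ) : ℝ) *
        2 ^ (-(k * (condEntropyXK p + condEntropyYK p + entropyK p - 3 * δ))) := by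
      rw [hprod]
      calc (1 : ℝ) / 64 = 1 / 4 * (1 / 4) * (1 / 4) := by norm_num
        _ ≤ _ := by gcongr
    exact h64.trans (mul_le_mul_of_nonneg_right (hcast hb) (htwo _).le)

end

open scoped Classical in
theorem mainTheorem1 {V E 𝒳 𝒴 : Type*} [Fintype V] [Fintype E] [Fintype 𝒳] [Fintype 𝒴]
    (G : Network V E) (hG : G.Acyclic) (C : E → ℕ) (sx sy : V) (T : Finset V)
    (hsx : sx ∉ T) (hsy : sy ∉ T) (p : PMF (𝒳 × 𝒴)) (hp : Feasible G C sx sy T p) :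
    ∃ ε₀ : ℝ, 0 < ε₀ ∧ ∀ ε : ℝ, 0 < ε → ε < ε₀ → ∃ N : ℕ, ∀ n : ℕ, N ≤ n →
      (FeasibleByDecomposition G (Network.delayed n C) sx sy T p ε ((1 - ε) * n) ↔
        RateLE (condEntropyXK p) (G.capacity C T {sx}) ∧
        RateLE (condEntropyYK p) (G.capacity C T {sy}) ∧
        RateLE (condEntropyXK p + condEntropyYK p + entropyK p) (G.capacity C T {sx, sy})) := by
  by_cases h : RateLE (condEntropyXK p) (G.capacity C T {sx}) ∧
      RateLE (condEntropyYK p) (G.capacity C T {sy}) ∧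
      RateLE (condEntropyXK p + condEntropyYK p + entropyK p) (G.capacity C T {sx, sy})
  · refine ⟨1, one_pos, fun ε h0 h1 => ?_⟩
    obtain ⟨N, hN⟩ := feasibleByDecomposition_of_rateLE hG h.1 h.2.1 h.2.2 h0 h1
    exact ⟨N, fun n hn => iff_of_true (hN n hn) h⟩
  · obtain ⟨ε₀, hε₀, hN⟩ := not_feasibleByDecomposition_of_not_rateLE hG h
    refine ⟨ε₀, hε₀, fun ε h0 h1 => ?_⟩
    obtain ⟨N, hN⟩ := hN ε h0 h1
    exact ⟨N, fun n hn => iff_of_false (hN n hn) h⟩
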